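/- Let $\mathbb D$ be the open unit disk, $dA=\frac1\pi\,r\,dr\,d\theta$ the normalized area measure, and $L^2_h$ the harmonic Bergman space of all complex-valued harmonic functions on $\mathbb D$ that lie in $L^2(\mathbb D,dA)$. Let $$Q\varphi(z)=\int_{\mathbb D}\Big(\frac1{(1-z\bar w)^2}+\frac1{(1-\bar z w)^2}-1\Big)\varphi(w)\,dA(w),\qquad z\in\mathbb D,\ \varphi\in L^1(\mathbb D,dA),$$ which on $L^2(\mathbb D,dA)$ is the orthogonal projection onto $L^2_h$. For $f\in L^1(\mathbb D,dA)$ the Toeplitz operator $T_f$ is defined on the harmonic polynomials $h$ by $T_fh=Q(fh)$; if it is bounded in the $L^2$ norm, $T_f$ also denotes its continuous extension to $L^2_h$. The polar coefficients of $f$ are the functions $f_n(r)=\frac1{2\pi}\int_{-\pi}^{\pi}f(re^{i\theta})e^{-in\theta}\,d\theta$, $n\in\mathbb Z$, defined for almost every $r\in(0,1)$. **Theorem.** Let $g(z)=\sum_{l\ge1}a_lz^l$ be a bounded analytic function on $\mathbb D$ and $u(z)=z+\overline{g(z)}=z+\sum_{l\ge1}\bar a_l\bar z^l$. Let $N\ge1$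 be an integer and let $f\in L^1(\mathbb D,dA)$ have a polar decomposition truncated above, $f(re^{i\theta})=\sum_{n=-\infty}^{N}e^{in\theta}f_n(r)$, that is, $f_n=0$ almost everywhere for every $n>N$. Assume that $g\not\equiv0$ or that $f\in L^2(\mathbb D,dA)$. If $T_f$ is bounded on $L^2_h$ and commutes with $T_u$, then there are constants $C_1,C_0\in\mathbb C$ such that $$T_f=C_1T_u+C_0I\qquad\text{and}\qquad f(z)=C_1z+C_0+C_1\sum_{n=1}^\infty\bar a_n\bar z^n\ \text{ for almost every } z\in\mathbb D.$$ If moreover $f_N$ is not almost everywhere zero, then $N=1$. -/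

import Mathlib

open MeasureTheory Metric Set
open scoped ComplexConjugate ENNReal

noncomputable section

namespace HarmonicBergman

/-- Normalized area measure `dA = r dr dθ / π` on the open unit disk, as a measure on `ℂ`. -/
def diskMeasure : Measure ℂ :=
  (ENNReal.ofReal Real.pi)⁻¹ • (volume.restrict (ball (0 : ℂ) 1))

/-- The harmonic Bergman space: the subspace of `L²(𝔻, dA)` of all classes that are
represented by a complex-valued function which is harmonic on the unit disk. -/
def L2h : Submodule ℂ (Lp ℂ 2 diskMeasure) where
  carrier := {h | ∃ F : ℂ → ℂ,
    InnerProductSpace.HarmonicOnNhd F (ball (0 : ℂ) 1) ∧ h =ᵐ[diskMeasure] F}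
  add_mem' := by
    rintro h k ⟨F, hF, hFe⟩ ⟨G, hG, hGe⟩
    refine ⟨F + G, hF.add hG, ?_⟩
    exact (Lp.coeFn_add h k).trans (hFe.add hGe)
  zero_mem' := by
    refine ⟨fun _ => 0, fun x _ => ⟨contDiffAt_const, ?_⟩, Lp.coeFn_zero ℂ 2 diskMeasure⟩
    exact Filter.Eventually.of_forall fun y => by
      simp [InnerProductSpace.laplacian_eq_iteratedFDeriv_orthonormalBasis _
        Complex.orthonormalBasisOneI]
  smul_mem' := by
    rintro c h ⟨F, hF, hFe⟩
    refine ⟨fun z => c * F z,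
      hF.comp_CLM ((ContinuousLinearMap.mul ℂ ℂ c).restrictScalars ℝ), ?_⟩
    refine (Lp.coeFn_smul c h).trans ?_
    filter_upwards [hFe] with z hz
    simp [hz]

/-- The reproducing kernel of the harmonic Bergman space. -/
def kernel (z w : ℂ) : ℂ :=
  1 / (1 - z * conj w) ^ 2 + 1 / (1 - conj z * w) ^ 2 - 1

/-- The integral operator `Q` with the harmonic Bergman kernel, which on `L²(𝔻, dA)` is the
orthogonal projection onto the harmonic Bergman space.  For `z` in the disk the kernel is a
bounded function of `w`, so the integral converges for every `φ` in `L¹(𝔻, dA)`. -/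
def Q (φ : ℂ → ℂ) (z : ℂ) : ℂ := ∫ w, kernel z w * φ w ∂diskMeasure

/-- The harmonic polynomial `p(z) + conj (q(z))`. -/
def harmonicPoly (p q : Polynomial ℂ) (z : ℂ) : ℂ := p.eval z + conj (q.eval z)

/-- `T` is the bounded Toeplitz operator `T_f` on the harmonic Bergman space: a bounded operator
with `T h = Q (f h)` for every harmonic polynomial `h`.  The harmonic polynomials are dense, so
there is at most one such `T`; there is one exactly when the densely defined
operator `h ↦ Q (f h)` on harmonic polynomials is bounded. -/
def IsToeplitz (f : ℂ → ℂ) (T : L2h →L[ℂ] L2h) : Prop :=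
  ∀ (p q : Polynomial ℂ) (h : L2h),
    (h : Lp ℂ 2 diskMeasure) =ᵐ[diskMeasure] harmonicPoly p q →
    (T h : Lp ℂ 2 diskMeasure) =ᵐ[diskMeasure] Q (fun w => f w * harmonicPoly p q w)

/-- The radial coefficient `f_n(r) = (1/2π) ∫ f(r e^{iθ}) e^{-inθ} dθ` in the polar
decomposition `f(r e^{iθ}) = ∑ e^{inθ} f_n(r)`. -/
def polarCoeff (f : ℂ → ℂ) (n : ℤ) (r : ℝ) : ℂ :=
  (1 / (2 * Real.pi) : ℂ) * ∫ θ in (-Real.pi)..Real.pi,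
    f (r * Complex.exp (θ * Complex.I)) * Complex.exp (-(n * θ * Complex.I))

/-- The polar coefficient `f_n` is the zero element of `L¹([0,1), r dr)`. -/
def PolarCoeffZero (f : ℂ → ℂ) (n : ℤ) : Prop :=
  ∀ᵐ r ∂(volume.restrict (Ioo (0 : ℝ) 1)), polarCoeff f n r = 0

/-- The polar decomposition of `f` has the form `∑_{n ≤ N} e^{inθ} f_n(r)`. -/
def TruncatedAbove (f : ℂ → ℂ) (N : ℤ) : Prop :=
  ∀ n : ℤ, N < n → PolarCoeffZero f n

end HarmonicBergman

end

/-! Write `e_k` for z^k (k ≥ 0) and conj z^|k| (k < 0). These are orthogonal with ‖e_k‖² = 1/(|k|+1)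
and span a dense subspace of `L2h`. In this system a Toeplitz operator has entries ⟨e_j, T_f e_k⟩ =
2∫ r^{|j|+|k|+1} f_{j-k}(r) dr, so the diagonal of index n sees only the polar coefficient f_n
(`IsToeplitz.entry_eq`). Everything is done with these matrices.

If f_n = 0 for n > N, the entry (k+N+1, k) of T_f T_u and of T_u T_f reduces to a single product,
because u has top index 1. Commutation then gives a two-term recurrence for the moments of f_N
(`radialMoment_recurrence`). For k ≥ 0 with k+N ≥ 0 it fixes these moments up to one constant D, and
completeness of the even powers yields f_N = D r^N (`exists_polarCoeff_eq_zpow`).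

The index now decides. For N ≥ 2 the recurrence at k = -1, where conj z passes to 1, contradicts D ≠
0 (`polarCoeffZero_of_two_le`), so the top index drops to 1. Subtracting C₁u and then C₀, whose
operators commute with T_u, leaves a symbol with only negative indices. For N ≤ -2 the function r^N
is not integrable against r dr (`polarCoeffZero_of_le_neg_two`).

The remaining case N = -1 is delicate, as 1/r is integrable against r dr. It is excluded either by
square integrability (`polarCoeffZero_neg_one_of_memLp`) or, when g ≢ 0, by one further matrix entry
involving the first nonzero coefficient of g (`polarCoeffZero_neg_one_of_ne_zero`). Descending
through all indices, every moment of the remainder vanishes, hence so do its matrix and, by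
Stone–Weierstrass, the function itself (`ae_eq_zero_of_radialMoment`). -/

noncomputable section

namespace HarmonicBergman

/-! ### Harmonic monomials and polar coordinates on the disk. -/

/-- The harmonic monomials: `z ^ k` for `k ≥ 0` and `conj z ^ (-k)` for `k < 0`. -/
def harmonicMonomial (k : ℤ) (z : ℂ) : ℂ := z ^ k.toNat * conj z ^ (-k).toNat

/-- The radial moments `2 ∫ r ^ (s + 1) f_n(r) dr` of the polar coefficient `f_n`. -/
def radialMoment (f : ℂ → ℂ) (n : ℤ) (s : ℕ) : ℂ :=
  2 * ∫ r in Ioo (0 : ℝ) 1, (r : ℂ) ^ (s + 1) * polarCoeff f n r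

lemma continuous_harmonicMonomial (k : ℤ) : Continuous (harmonicMonomial k) := by
  unfold harmonicMonomial
  fun_prop

lemma toNat_add_toNat_neg (k : ℤ) : k.toNat + (-k).toNat = k.natAbs := by omega

lemma norm_harmonicMonomial (k : ℤ) (z : ℂ) : ‖harmonicMonomial k z‖ = ‖z‖ ^ k.natAbs := by
  rw [harmonicMonomial, norm_mul, norm_pow, norm_pow, RCLike.norm_conj, ← pow_add,
    toNat_add_toNat_neg]

lemma norm_harmonicMonomial_le_one (k : ℤ) {z : ℂ} (hz : z ∈ ball (0 : ℂ) 1) :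
    ‖harmonicMonomial k z‖ ≤ 1 := by
  rw [norm_harmonicMonomial]
  exact pow_le_one₀ (norm_nonneg _) (by simpa using (mem_ball_zero_iff.1 hz).le)

lemma harmonicMonomial_polar (k : ℤ) (r θ : ℝ) :
    harmonicMonomial k (r * Complex.exp (θ * Complex.I)) =
      (r : ℂ) ^ k.natAbs * Complex.exp (k * θ * Complex.I) := by
  have h : conj ((r : ℂ) * Complex.exp (θ * Complex.I)) = r * Complex.exp (-(θ * Complex.I)) := by
    rw [map_mul, ← Complex.exp_conj]
    simp
  rw [harmonicMonomial, h, mul_pow, mul_pow, ← toNat_add_toNat_neg k, pow_add,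
    mul_mul_mul_comm, ← Complex.exp_nat_mul, ← Complex.exp_nat_mul, ← Complex.exp_add]
  congr 2
  have : (k : ℂ) = (k.toNat : ℂ) - ((-k).toNat : ℂ) := by
    have : k = (k.toNat : ℤ) - ((-k).toNat : ℤ) := by omega
    exact_mod_cast this
  rw [this]
  ring

lemma integrable_diskMeasure_iff {F : ℂ → ℂ} :
    Integrable F diskMeasure ↔ IntegrableOn F (ball (0 : ℂ) 1) := by
  rw [diskMeasure, integrable_smul_measure (by simp) (by simpa using Real.pi_pos), IntegrableOn]

lemma ae_diskMeasure_iff {p : ℂ → Prop} :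
    (∀ᵐ z ∂diskMeasure, p z) ↔ ∀ᵐ z ∂(volume.restrict (ball (0 : ℂ) 1)), p z := by
  rw [diskMeasure, Measure.ae_ennreal_smul_measure_iff (by simp)]

lemma ae_mem_ball : ∀ᵐ z ∂diskMeasure, z ∈ ball (0 : ℂ) 1 :=
  ae_diskMeasure_iff.2 (ae_restrict_mem measurableSet_ball)

instance : IsFiniteMeasure diskMeasure := by
  refine ⟨?_⟩
  rw [diskMeasure, Measure.smul_apply, Measure.restrict_apply_univ, smul_eq_mul]
  exact ENNReal.mul_lt_top (by simpa using Real.pi_pos) measure_ball_lt_top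

lemma integral_diskMeasure (F : ℂ → ℂ) :
    ∫ z, F z ∂diskMeasure = (1 / Real.pi : ℂ) * ∫ z in ball (0 : ℂ) 1, F z := by
  rw [diskMeasure, integral_smul_measure, ENNReal.toReal_inv,
    ENNReal.toReal_ofReal Real.pi_pos.le, Complex.real_smul]
  simp

lemma polarCoord_symm_eq (p : ℝ × ℝ) :
    Complex.polarCoord.symm p = p.1 * Complex.exp (p.2 * Complex.I) := by
  rw [Complex.polarCoord_symm_apply, Complex.exp_mul_I]
  simp

lemma polar_mem_ball_iff {p : ℝ × ℝ} (hp : p ∈ polarCoord.target) :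
    (p.1 : ℂ) * Complex.exp (p.2 * Complex.I) ∈ ball (0 : ℂ) 1 ↔
      p ∈ Ioo (0 : ℝ) 1 ×ˢ Ioo (-Real.pi) Real.pi := by
  have h0 : 0 < p.1 := hp.1
  have h1 : p.2 ∈ Ioo (-Real.pi) Real.pi := hp.2
  rw [mem_ball_zero_iff, norm_mul, Complex.norm_exp_ofReal_mul_I, mul_one, Complex.norm_real,
    Real.norm_of_nonneg h0.le, mem_prod]
  simp [h0, h1.1, h1.2]

/-- Change of variables with Jacobian r. Keeping the factor r in the integrand gives a function
integrable for plain Lebesgue measure, to which Fubini applies. -/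
lemma integrable_polar {F : ℂ → ℂ} (hF : Integrable F) :
    IntegrableOn (fun p : ℝ × ℝ => (p.1 : ℂ) * F (p.1 * Complex.exp (p.2 * Complex.I)))
      polarCoord.target := by
  have h1 : Integrable (F ∘ Complex.measurableEquivRealProd.symm) :=
    (Complex.volume_preserving_equiv_real_prod.symm).integrable_comp_of_integrable hF
  have h2 := (integrableOn_image_iff_integrableOn_abs_det_fderiv_smul volume
    (polarCoord.open_target.measurableSet)
    (fun p _ => (hasFDerivAt_polarCoord_symm p).hasFDerivWithinAt)
    polarCoord.symm.injOn (F ∘ Complex.measurableEquivRealProd.symm)).1 h1.integrableOn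
  refine h2.congr_fun (fun p hp => ?_) polarCoord.open_target.measurableSet
  have h0 : 0 < p.1 := hp.1
  simp only [Function.comp, det_fderivPolarCoordSymm, abs_of_pos h0]
  rw [Complex.measurableEquivRealProd_symm_polarCoord_symm_apply, polarCoord_symm_eq,
    Complex.real_smul]

lemma disk_prod_subset : Ioo (0 : ℝ) 1 ×ˢ Ioo (-Real.pi) Real.pi ⊆ polarCoord.target :=
  fun _ hp => ⟨hp.1.1, hp.2⟩

lemma integrableOn_polar {F : ℂ → ℂ} (hF : Integrable F diskMeasure) :
    IntegrableOn (fun p : ℝ × ℝ => (p.1 : ℂ) * F (p.1 * Complex.exp (p.2 * Complex.I)))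
      (Ioo (0 : ℝ) 1 ×ˢ Ioo (-Real.pi) Real.pi) := by
  have h1 := integrable_polar ((integrable_indicator_iff measurableSet_ball).2
    (integrable_diskMeasure_iff.1 hF))
  refine (h1.mono_set disk_prod_subset).congr_fun (fun p hp => ?_)
    (measurableSet_Ioo.prod measurableSet_Ioo)
  simp only
  rw [indicator_of_mem ((polar_mem_ball_iff (disk_prod_subset hp)).2 hp)]

lemma integrable_polar_prod {F : ℂ → ℂ} (hF : Integrable F diskMeasure) :
    Integrable (fun p : ℝ × ℝ => (p.1 : ℂ) * F (p.1 * Complex.exp (p.2 * Complex.I)))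
      ((volume.restrict (Ioo (0 : ℝ) 1)).prod (volume.restrict (Ioo (-Real.pi) Real.pi))) := by
  have h := integrableOn_polar hF
  rwa [IntegrableOn, Measure.volume_eq_prod, ← Measure.prod_restrict] at h

lemma intervalIntegral_eq_Ioo (G : ℝ → ℂ) :
    ∫ θ in (-Real.pi)..Real.pi, G θ = ∫ θ in Ioo (-Real.pi) Real.pi, G θ := by
  rw [intervalIntegral.integral_of_le (by linarith [Real.pi_pos]), integral_Ioc_eq_integral_Ioo]

/-- An integrable function on the disk is integrable on almost every circle. -/
lemma ae_integrableOn_circle {F : ℂ → ℂ} (hF : Integrable F diskMeasure) :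
    ∀ᵐ r : ℝ ∂(volume.restrict (Ioo (0 : ℝ) 1)),
      IntervalIntegrable (fun θ : ℝ => F (r * Complex.exp (θ * Complex.I))) volume
        (-Real.pi) Real.pi := by
  filter_upwards [(integrable_polar_prod hF).prod_right_ae, ae_restrict_mem measurableSet_Ioo]
    with r hr h0
  rw [intervalIntegrable_iff_integrableOn_Ioo_of_le (by linarith [Real.pi_pos])]
  have hr0 : (r : ℂ) ≠ 0 := by exact_mod_cast h0.1.ne'
  refine (hr.const_mul (r : ℂ)⁻¹).congr (Filter.Eventually.of_forall fun θ => ?_)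
  simp only
  rw [inv_mul_cancel_left₀ hr0]

lemma polarCoeff_zero_eq (F : ℂ → ℂ) (r : ℝ) :
    polarCoeff F 0 r = (1 / (2 * Real.pi) : ℂ) *
      ∫ θ in Ioo (-Real.pi) Real.pi, F (r * Complex.exp (θ * Complex.I)) := by
  simp [polarCoeff, intervalIntegral_eq_Ioo]

lemma integrableOn_mul_polarCoeff_zero {F : ℂ → ℂ} (hF : Integrable F diskMeasure) :
    IntegrableOn (fun r : ℝ => (r : ℂ) * polarCoeff F 0 r) (Ioo (0 : ℝ) 1) := by
  refine ((integrable_polar_prod hF).integral_prod_left.const_mul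
    (1 / (2 * Real.pi) : ℂ)).congr (Filter.Eventually.of_forall fun r => ?_)
  simp only
  rw [polarCoeff_zero_eq, integral_const_mul]
  ring

/-- Integration over the disk in polar coordinates. -/
lemma integral_eq_polarCoeff_zero {F : ℂ → ℂ} (hF : Integrable F diskMeasure) :
    ∫ z, F z ∂diskMeasure = 2 * ∫ r in Ioo (0 : ℝ) 1, (r : ℂ) * polarCoeff F 0 r := by
  have h1 : ∫ z in ball (0 : ℂ) 1, F z =
      ∫ p in Ioo (0 : ℝ) 1 ×ˢ Ioo (-Real.pi) Real.pi,
        (p.1 : ℂ) * F (p.1 * Complex.exp (p.2 * Complex.I)) := by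
    rw [← integral_indicator measurableSet_ball, ← Complex.integral_comp_polarCoord_symm,
      ← integral_indicator polarCoord.open_target.measurableSet,
      ← integral_indicator (measurableSet_Ioo.prod measurableSet_Ioo)]
    congr 1
    ext p
    by_cases hp : p ∈ polarCoord.target
    · rw [indicator_of_mem hp, polarCoord_symm_eq]
      by_cases hq : p ∈ Ioo (0 : ℝ) 1 ×ˢ Ioo (-Real.pi) Real.pi
      · rw [indicator_of_mem hq, indicator_of_mem ((polar_mem_ball_iff hp).2 hq),
          Complex.real_smul]
      · rw [indicator_of_notMem hq, indicator_of_notMem (mt (polar_mem_ball_iff hp).1 hq),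
          smul_zero]
    · rw [indicator_of_notMem hp, indicator_of_notMem (fun h => hp (disk_prod_subset h))]
  have h2 : ∀ r : ℝ, (r : ℂ) * polarCoeff F 0 r = (1 / (2 * Real.pi) : ℂ) *
      ∫ θ in Ioo (-Real.pi) Real.pi, (r : ℂ) * F (r * Complex.exp (θ * Complex.I)) := by
    intro r
    rw [polarCoeff_zero_eq, integral_const_mul]
    ring
  have h3 := integral_prod _ (integrable_polar_prod hF)
  rw [integral_diskMeasure, h1, Measure.volume_eq_prod, ← Measure.prod_restrict, h3]
  simp_rw [h2]
  rw [integral_const_mul]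
  rw [← mul_assoc]
  congr 1
  have : (Real.pi : ℂ) ≠ 0 := by exact_mod_cast Real.pi_ne_zero
  field_simp

/-! ### Polar coefficients and radial moments. -/

lemma polarCoeff_conj_mul_mul (f : ℂ → ℂ) (j k : ℤ) (r : ℝ) :
    polarCoeff (fun z => conj (harmonicMonomial j z) * (f z * harmonicMonomial k z)) 0 r =
      (r : ℂ) ^ (j.natAbs + k.natAbs) * polarCoeff f (j - k) r := by
  simp only [polarCoeff]
  rw [mul_left_comm, ← intervalIntegral.integral_const_mul ((r : ℂ) ^ (j.natAbs + k.natAbs))]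
  congr 1
  refine intervalIntegral.integral_congr fun θ _ => ?_
  rw [harmonicMonomial_polar, harmonicMonomial_polar, map_mul, ← Complex.exp_conj]
  simp only [map_mul, map_pow, Complex.conj_ofReal, Complex.conj_I, map_intCast]
  have : Complex.exp (-(((j - k : ℤ) : ℂ) * θ * Complex.I)) =
      Complex.exp (↑j * ↑θ * -Complex.I) * Complex.exp (↑k * ↑θ * Complex.I) := by
    rw [← Complex.exp_add]; congr 1; push_cast; ring
  rw [this]
  simp [pow_add]
  ring

lemma integrable_mul_of_bounded {f φ : ℂ → ℂ} (hf : Integrable f diskMeasure)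
    (hφ : ContinuousOn φ (ball (0 : ℂ) 1)) {C : ℝ} (hC : ∀ z ∈ ball (0 : ℂ) 1, ‖φ z‖ ≤ C) :
    Integrable (fun z => φ z * f z) diskMeasure := by
  refine hf.bdd_mul (c := C) ?_ (ae_mem_ball.mono hC)
  rw [diskMeasure]
  exact (hφ.aestronglyMeasurable measurableSet_ball).smul_measure _

lemma integrable_mul_harmonicMonomial {f : ℂ → ℂ} (hf : Integrable f diskMeasure) (k : ℤ) :
    Integrable (fun z => f z * harmonicMonomial k z) diskMeasure := by
  simp_rw [mul_comm (f _)]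
  exact integrable_mul_of_bounded hf (continuous_harmonicMonomial k).continuousOn
    (fun z hz => norm_harmonicMonomial_le_one k hz)

lemma integrable_conj_harmonicMonomial_mul {f : ℂ → ℂ} (hf : Integrable f diskMeasure) (k : ℤ) :
    Integrable (fun z => conj (harmonicMonomial k z) * f z) diskMeasure :=
  integrable_mul_of_bounded hf
    (Complex.continuous_conj.comp (continuous_harmonicMonomial k)).continuousOn
    (fun z hz => by simpa using norm_harmonicMonomial_le_one k hz)

lemma integral_conj_mul_mul {f : ℂ → ℂ} (hf : Integrable f diskMeasure) (j k : ℤ) :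
    ∫ z, conj (harmonicMonomial j z) * (f z * harmonicMonomial k z) ∂diskMeasure =
      radialMoment f (j - k) (j.natAbs + k.natAbs) := by
  rw [integral_eq_polarCoeff_zero
    (integrable_conj_harmonicMonomial_mul (integrable_mul_harmonicMonomial hf k) j), radialMoment]
  simp_rw [polarCoeff_conj_mul_mul]
  congr 2
  ext r
  ring

lemma harmonicMonomial_zero (z : ℂ) : harmonicMonomial 0 z = 1 := by simp [harmonicMonomial]

lemma integral_conj_mul {f : ℂ → ℂ} (hf : Integrable f diskMeasure) (j : ℤ) :
    ∫ z, conj (harmonicMonomial j z) * f z ∂diskMeasure = radialMoment f j j.natAbs := by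
  simpa [harmonicMonomial_zero] using integral_conj_mul_mul hf j 0

/-- The polar coefficients of `f` belong to `L¹((0, 1), r dr)`. -/
lemma integrableOn_mul_polarCoeff {f : ℂ → ℂ} (hf : Integrable f diskMeasure) (n : ℤ) :
    IntegrableOn (fun r : ℝ => (r : ℂ) * polarCoeff f n r) (Ioo (0 : ℝ) 1) := by
  -- The factor (z/|z|)^(-n) equals e^{-inθ} off the origin and moves index n to index 0. At the
  -- origin 0/0 = 0, so the norm is only bounded by 1.
  have hb : ∀ z : ℂ, ‖(z / ‖z‖) ^ (-n)‖ ≤ 1 := by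
    intro z
    rcases eq_or_ne z 0 with rfl | hz
    · rcases eq_or_ne n 0 with rfl | hn <;> simp [*, zero_zpow]
    · have : ‖z‖ ≠ 0 := norm_ne_zero_iff.2 hz
      simp [this]
  have hm : Measurable fun z : ℂ => (z / (‖z‖ : ℂ)) ^ (-n) := by
    rcases le_total 0 (-n) with h | h
    · lift (-n) to ℕ using h with m
      simp only [zpow_natCast]
      fun_prop
    · obtain ⟨m, hm⟩ := Int.eq_ofNat_of_zero_le (neg_nonneg.2 h)
      rw [show -n = -(m : ℤ) by omega]
      simp only [zpow_neg, zpow_natCast]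
      fun_prop
  have hi : Integrable (fun z => (z / (‖z‖ : ℂ)) ^ (-n) * f z) diskMeasure :=
    hf.bdd_mul (c := 1) hm.aestronglyMeasurable (Filter.Eventually.of_forall hb)
  refine (integrableOn_mul_polarCoeff_zero hi).congr_fun (fun r hr => ?_) measurableSet_Ioo
  have hr0 : (r : ℂ) ≠ 0 := by exact_mod_cast hr.1.ne'
  simp only [polarCoeff]
  congr 3
  ext θ
  simp only [norm_mul, Complex.norm_exp_ofReal_mul_I, mul_one, Complex.norm_real,
    Real.norm_of_nonneg hr.1.le]
  rw [mul_div_cancel_left₀ _ hr0, ← Complex.exp_int_mul]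
  simp
  rw [mul_comm]
  congr 2
  ring

lemma integrableOn_pow_mul_polarCoeff {f : ℂ → ℂ} (hf : Integrable f diskMeasure) (n : ℤ)
    (s : ℕ) :
    IntegrableOn (fun r : ℝ => (r : ℂ) ^ (s + 1) * polarCoeff f n r) (Ioo (0 : ℝ) 1) := by
  have h := (integrableOn_mul_polarCoeff hf n).bdd_mul (c := 1) (f := fun r : ℝ => (r : ℂ) ^ s)
    (by fun_prop) ?_
  · refine h.congr (Filter.Eventually.of_forall fun r => ?_)
    simp only
    ring
  · filter_upwards [ae_restrict_mem measurableSet_Ioo] with r hr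
    rw [norm_pow, Complex.norm_real, Real.norm_of_nonneg hr.1.le]
    exact pow_le_one₀ hr.1.le hr.2.le

/-- Linearity holds on circles where both functions are integrable; that null set does not depend on
n, so the quantifier over n stays inside. -/
lemma ae_polarCoeff_sub {f g : ℂ → ℂ} (hf : Integrable f diskMeasure)
    (hg : Integrable g diskMeasure) (c : ℂ) :
    ∀ᵐ r : ℝ ∂(volume.restrict (Ioo (0 : ℝ) 1)), ∀ n : ℤ,
      polarCoeff (fun z => f z - c * g z) n r = polarCoeff f n r - c * polarCoeff g n r := by
  filter_upwards [ae_integrableOn_circle hf, ae_integrableOn_circle hg] with r h1 h2 n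
  have hc : ∀ h : ℝ → ℂ, IntervalIntegrable h volume (-Real.pi) Real.pi →
      IntervalIntegrable (fun θ : ℝ => h θ * Complex.exp (-(n * θ * Complex.I))) volume
        (-Real.pi) Real.pi :=
    fun h hh => hh.mul_continuousOn (by fun_prop)
  simp only [polarCoeff]
  rw [mul_left_comm, ← mul_sub, ← intervalIntegral.integral_const_mul c,
    ← intervalIntegral.integral_sub (hc _ h1) ((hc _ h2).const_mul c)]
  congr 2
  ext θ
  ring

lemma radialMoment_sub {f g : ℂ → ℂ} (hf : Integrable f diskMeasure)
    (hg : Integrable g diskMeasure) (c : ℂ) (n : ℤ) (s : ℕ) :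
    radialMoment (fun z => f z - c * g z) n s = radialMoment f n s - c * radialMoment g n s := by
  simp only [radialMoment]
  rw [mul_left_comm, ← mul_sub, ← integral_const_mul c,
    ← integral_sub (integrableOn_pow_mul_polarCoeff hf n s)
      ((integrableOn_pow_mul_polarCoeff hg n s).const_mul c)]
  congr 1
  refine integral_congr_ae ?_
  filter_upwards [ae_polarCoeff_sub hf hg c] with r hr
  rw [hr n]
  ring

lemma radialMoment_congr_ae {f : ℂ → ℂ} {n : ℤ} {φ : ℝ → ℂ}
    (h : ∀ᵐ r : ℝ ∂(volume.restrict (Ioo (0 : ℝ) 1)), polarCoeff f n r = φ r) (s : ℕ) :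
    radialMoment f n s = 2 * ∫ r in Ioo (0 : ℝ) 1, (r : ℂ) ^ (s + 1) * φ r := by
  rw [radialMoment]
  congr 1
  refine integral_congr_ae ?_
  filter_upwards [h] with r hr
  rw [hr]

lemma PolarCoeffZero.radialMoment_eq_zero {f : ℂ → ℂ} {n : ℤ} (h : PolarCoeffZero f n) (s : ℕ) :
    radialMoment f n s = 0 := by
  rw [radialMoment_congr_ae h]
  simp

lemma integral_Ioo_pow (s : ℕ) : ∫ r in Ioo (0 : ℝ) 1, (r : ℂ) ^ s = 1 / (s + 1) := by
  rw [← integral_Ioc_eq_integral_Ioo, ← intervalIntegral.integral_of_le zero_le_one]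
  have : ∀ r : ℝ, (r : ℂ) ^ s = ((r ^ s : ℝ) : ℂ) := fun r => by push_cast; rfl
  simp_rw [this]
  rw [intervalIntegral.integral_ofReal, integral_pow]
  simp

/-- The radial moments of a polar coefficient that is a power of the radius. -/
lemma radialMoment_of_pow {f : ℂ → ℂ} {n : ℤ} {c : ℂ} {m : ℤ}
    (h : ∀ᵐ r : ℝ ∂(volume.restrict (Ioo (0 : ℝ) 1)), polarCoeff f n r = c * (r : ℂ) ^ m) (s : ℕ)
    (hs : 0 ≤ (s : ℤ) + 1 + m) :
    radialMoment f n s = 2 * c / (s + m + 2) := by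
  rw [radialMoment_congr_ae h]
  -- A negative m is allowed as long as the total exponent t = s + 1 + m is a natural number.
  obtain ⟨t, ht⟩ := Int.eq_ofNat_of_zero_le hs
  have h1 : ∫ r in Ioo (0 : ℝ) 1, (r : ℂ) ^ (s + 1) * (c * (r : ℂ) ^ m) =
      ∫ r in Ioo (0 : ℝ) 1, c * (r : ℂ) ^ t := by
    refine setIntegral_congr_fun measurableSet_Ioo fun r hr => ?_
    have hr0 : (r : ℂ) ≠ 0 := by exact_mod_cast hr.1.ne'
    rw [mul_left_comm, ← zpow_natCast, ← zpow_natCast (r : ℂ) t, ← zpow_add₀ hr0]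
    congr 2
  rw [h1, integral_const_mul, integral_Ioo_pow]
  have h2 : (t : ℂ) = s + 1 + m := by exact_mod_cast ht.symm
  rw [h2]
  ring

/-! ### Expansions in harmonic monomials. -/

/-- `F = ∑ c_k e_k` pointwise on the disk, where `e_k` are the harmonic monomials. -/
def HasHarmonicExpansion (F : ℂ → ℂ) (c : ℤ → ℂ) : Prop :=
  ∀ z ∈ ball (0 : ℂ) 1, HasSum (fun k => c k * harmonicMonomial k z) (F z)

/-- The two-sided sequence of coefficients of `∑ p_n z ^ n + conj (∑_{n ≥ 1} q_n z ^ n)`. -/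
def twoSided (p q : ℕ → ℂ) (k : ℤ) : ℂ := if 0 ≤ k then p k.toNat else conj (q (-k).toNat)

lemma twoSided_natCast (p q : ℕ → ℂ) (n : ℕ) : twoSided p q n = p n := by simp [twoSided]

lemma twoSided_neg (p q : ℕ → ℂ) (n : ℕ) :
    twoSided p q (-((n : ℤ) + 1)) = conj (q (n + 1)) := by
  have h1 : ¬ (0 : ℤ) ≤ -((n : ℤ) + 1) := by omega
  have h2 : (-(-((n : ℤ) + 1))).toNat = n + 1 := by omega
  rw [twoSided, if_neg h1, h2]

lemma harmonicMonomial_natCast (n : ℕ) (z : ℂ) : harmonicMonomial n z = z ^ n := by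
  simp [harmonicMonomial]

lemma harmonicMonomial_neg (n : ℕ) (z : ℂ) :
    harmonicMonomial (-((n : ℤ) + 1)) z = conj z ^ (n + 1) := by
  have h1 : (-((n : ℤ) + 1)).toNat = 0 := by omega
  have h2 : (-(-((n : ℤ) + 1))).toNat = n + 1 := by omega
  rw [harmonicMonomial, h1, h2, pow_zero, one_mul]

lemma hasHarmonicExpansion_of_hasSum {p q : ℕ → ℂ} {P G : ℂ → ℂ}
    (hP : ∀ z ∈ ball (0 : ℂ) 1, HasSum (fun n => p n * z ^ n) (P z))
    (hG : ∀ z ∈ ball (0 : ℂ) 1, HasSum (fun n => q n * z ^ n) (G z)) :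
    HasHarmonicExpansion (fun z => P z + conj (G z - q 0)) (twoSided p q) := by
  intro z hz
  refine HasSum.of_nat_of_neg_add_one ?_ ?_
  · simp_rw [twoSided_natCast, harmonicMonomial_natCast]
    exact hP z hz
  · simp_rw [twoSided_neg, harmonicMonomial_neg]
    have h := (hasSum_nat_add_iff' 1).2 (hG z hz)
    have h2 := h.map (starRingEnd ℂ) Complex.continuous_conj
    simpa [Function.comp_def] using h2

lemma HasHarmonicExpansion.add_const {F : ℂ → ℂ} {c : ℤ → ℂ} (h : HasHarmonicExpansion F c)
    (b : ℂ) : HasHarmonicExpansion (fun z => F z + b) (fun k => c k + if k = 0 then b else 0) := by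
  intro z hz
  have h1 : HasSum (fun k : ℤ => (if k = 0 then b else 0) * harmonicMonomial k z) b := by
    have := hasSum_ite_eq (0 : ℤ) b
    refine this.congr_fun fun k => ?_
    split_ifs with hk
    · rw [hk, harmonicMonomial_zero, mul_one]
    · rw [zero_mul]
  simp_rw [add_mul]
  exact (h z hz).add h1

lemma exists_hasSum_of_analyticOnNhd {F : ℂ → ℂ} (hF : AnalyticOnNhd ℂ F (ball (0 : ℂ) 1)) :
    ∃ p : ℕ → ℂ, ∀ z ∈ ball (0 : ℂ) 1, HasSum (fun n => p n * z ^ n) (F z) := by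
  refine ⟨fun n => (n.factorial : ℂ)⁻¹ * iteratedDeriv n F 0, fun z hz => ?_⟩
  have h := Complex.hasSum_taylorSeries_on_ball hF.differentiableOn hz
  refine h.congr_fun fun n => ?_
  simp only [sub_zero, smul_eq_mul]
  ring

/-- A complex-valued harmonic function on the disk is the sum of a series of harmonic
monomials. -/
lemma exists_hasHarmonicExpansion {F : ℂ → ℂ}
    (hF : InnerProductSpace.HarmonicOnNhd F (ball (0 : ℂ) 1)) :
    ∃ c, HasHarmonicExpansion F c := by
  obtain ⟨G₁, hG₁, h₁⟩ := (hF.comp_CLM Complex.reCLM).exists_analyticOnNhd_ball_re_eq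
  obtain ⟨G₂, hG₂, h₂⟩ := (hF.comp_CLM Complex.imCLM).exists_analyticOnNhd_ball_re_eq
  -- With Re F = Re G₁ and Im F = Re G₂, one has F = (G₁ + iG₂)/2 + conj((G₁ - iG₂)/2).
  have hP : AnalyticOnNhd ℂ (fun z => (1 / 2 : ℂ) * (G₁ z + Complex.I * G₂ z))
      (ball (0 : ℂ) 1) :=
    analyticOnNhd_const.mul (hG₁.add (analyticOnNhd_const.mul hG₂))
  have hG : AnalyticOnNhd ℂ (fun z => (1 / 2 : ℂ) * (G₁ z - Complex.I * G₂ z))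
      (ball (0 : ℂ) 1) :=
    analyticOnNhd_const.mul (hG₁.sub (analyticOnNhd_const.mul hG₂))
  obtain ⟨p, hp⟩ := exists_hasSum_of_analyticOnNhd hP
  obtain ⟨q, hq⟩ := exists_hasSum_of_analyticOnNhd hG
  -- `twoSided` discards q 0, so its conjugate is added back at index 0.
  refine ⟨fun k => twoSided p q k + if k = 0 then conj (q 0) else 0, fun z hz => ?_⟩
  have h := (hasHarmonicExpansion_of_hasSum hp hq).add_const (conj (q 0)) z hz
  convert h using 1
  have e₁ := h₁ hz
  have e₂ := h₂ hz
  simp only [Function.comp, Complex.reCLM_apply, Complex.imCLM_apply] at e₁ e₂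
  apply Complex.ext
  · simp [← e₁]; ring
  · simp [← e₂]; ring

/-- Convergence at the real point r is absolute, and the resulting majorant serves the whole circle
of radius r. -/
lemma HasHarmonicExpansion.summable {F : ℂ → ℂ} {c : ℤ → ℂ} (h : HasHarmonicExpansion F c)
    {r : ℝ} (hr : r ∈ Ioo (0 : ℝ) 1) : Summable fun k => ‖c k‖ * r ^ k.natAbs := by
  have hz : (r : ℂ) ∈ ball (0 : ℂ) 1 := by
    simpa [abs_of_pos hr.1] using hr.2
  refine (h _ hz).summable.norm.congr fun k => ?_
  rw [norm_mul, norm_harmonicMonomial, Complex.norm_real, Real.norm_of_nonneg hr.1.le]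

lemma integral_exp_int_mul (n : ℤ) :
    ∫ θ : ℝ in (-Real.pi)..Real.pi, Complex.exp (n * θ * Complex.I) =
      if n = 0 then 2 * (Real.pi : ℂ) else 0 := by
  split_ifs with h
  · simp [h]; ring
  · have h0 : (n : ℂ) * Complex.I ≠ 0 := by simp [h]
    have : ∀ θ : ℝ, Complex.exp (n * θ * Complex.I) = Complex.exp (n * Complex.I * θ) :=
      fun θ => by congr 1; ring
    simp_rw [this]
    rw [integral_exp_mul_complex h0, div_eq_zero_iff]
    left
    rw [sub_eq_zero, Complex.exp_eq_exp_iff_exists_int]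
    refine ⟨n, ?_⟩
    push_cast
    ring

/-- Termwise integration over the circle, dominated by the absolute series at radius r;
orthogonality of the exponentials leaves one term. -/
lemma HasHarmonicExpansion.polarCoeff_eq {F : ℂ → ℂ} {c : ℤ → ℂ} (h : HasHarmonicExpansion F c)
    (j : ℤ) {r : ℝ} (hr : r ∈ Ioo (0 : ℝ) 1) : polarCoeff F j r = c j * (r : ℂ) ^ j.natAbs := by
  have h1 : HasSum (fun k : ℤ => ∫ θ : ℝ in (-Real.pi)..Real.pi,
      c k * (r : ℂ) ^ k.natAbs * Complex.exp (((k - j : ℤ) : ℂ) * θ * Complex.I))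
      (∫ θ : ℝ in (-Real.pi)..Real.pi,
        F (r * Complex.exp (θ * Complex.I)) * Complex.exp (-(j * θ * Complex.I))) := by
    refine intervalIntegral.hasSum_integral_of_dominated_convergence
      (fun k _ => ‖c k‖ * r ^ k.natAbs) (fun k => ?_) (fun k => ?_) ?_ ?_ ?_
    · exact Continuous.aestronglyMeasurable (by fun_prop)
    · refine Filter.Eventually.of_forall fun θ _ => ?_
      have : ((k - j : ℤ) : ℂ) * θ * Complex.I = (((k - j : ℤ) * θ : ℝ) : ℂ) * Complex.I := by
        push_cast; ring
      rw [norm_mul, this, Complex.norm_exp_ofReal_mul_I, mul_one, norm_mul, norm_pow,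
        Complex.norm_real, Real.norm_of_nonneg hr.1.le]
    · exact Filter.Eventually.of_forall fun θ _ => h.summable hr
    · exact intervalIntegrable_const
    · refine Filter.Eventually.of_forall fun θ _ => ?_
      have hz : (r : ℂ) * Complex.exp (θ * Complex.I) ∈ ball (0 : ℂ) 1 := by
        simpa [Complex.norm_exp_ofReal_mul_I, abs_of_pos hr.1] using hr.2
      refine ((h _ hz).mul_right (Complex.exp (-(j * θ * Complex.I)))).congr_fun fun k => ?_
      have e : Complex.exp (((k - j : ℤ) : ℂ) * θ * Complex.I) =
          Complex.exp (k * θ * Complex.I) * Complex.exp (-(j * θ * Complex.I)) := by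
        rw [← Complex.exp_add]; congr 1; push_cast; ring
      rw [harmonicMonomial_polar, e]
      ring
  have h2 := hasSum_ite_eq j (c j * (r : ℂ) ^ j.natAbs * (2 * Real.pi))
  have h3 : ∀ k : ℤ, ∫ θ : ℝ in (-Real.pi)..Real.pi,
      c k * (r : ℂ) ^ k.natAbs * Complex.exp (((k - j : ℤ) : ℂ) * θ * Complex.I) =
      if k = j then c j * (r : ℂ) ^ j.natAbs * (2 * Real.pi) else 0 := by
    intro k
    rw [intervalIntegral.integral_const_mul, integral_exp_int_mul]
    by_cases hk : k = j
    · simp [hk]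
    · simp [hk, sub_eq_zero]
  simp_rw [h3] at h1
  rw [polarCoeff, h1.unique h2]
  have : (Real.pi : ℂ) ≠ 0 := by exact_mod_cast Real.pi_ne_zero
  field_simp

lemma HasHarmonicExpansion.radialMoment_eq {F : ℂ → ℂ} {c : ℤ → ℂ}
    (h : HasHarmonicExpansion F c) (j : ℤ) (s : ℕ) :
    radialMoment F j s = 2 * c j / (s + j.natAbs + 2) := by
  have := radialMoment_of_pow (f := F) (n := j) (c := c j) (m := j.natAbs)
    ((ae_restrict_mem measurableSet_Ioo).mono fun r hr => by
      rw [h.polarCoeff_eq j hr, zpow_natCast]) s (by positivity)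
  rwa [Int.cast_natCast] at this

/-! ### The kernel and the operator `Q`. -/

/-- Each square expands as ∑ (n+1)xⁿ; the -1 in the kernel removes the constant term that would be
counted twice, so the conjugate half starts at n = 1. -/
lemma kernel_hasSum {z w : ℂ} (hz : z ∈ ball (0 : ℂ) 1) (hw : w ∈ ball (0 : ℂ) 1) :
    HasSum (fun k : ℤ => ((k.natAbs : ℂ) + 1) * harmonicMonomial k z *
      conj (harmonicMonomial k w)) (kernel z w) := by
  have hlt : ‖z‖ * ‖w‖ < 1 :=
    mul_lt_one_of_nonneg_of_lt_one_left (norm_nonneg _) (mem_ball_zero_iff.1 hz)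
      (mem_ball_zero_iff.1 hw).le
  have hx := hasSum_choose_mul_geometric_of_norm_lt_one (𝕜 := ℂ) 1 (r := z * conj w)
    (by simpa using hlt)
  have hy := hasSum_choose_mul_geometric_of_norm_lt_one (𝕜 := ℂ) 1 (r := conj z * w)
    (by simpa using hlt)
  have hk : kernel z w = 1 / (1 - z * conj w) ^ (1 + 1) + (1 / (1 - conj z * w) ^ (1 + 1) - 1) := by
    rw [kernel]; ring
  rw [hk]
  refine HasSum.of_nat_of_neg_add_one ?_ ?_
  · refine hx.congr_fun fun n => ?_
    rw [harmonicMonomial_natCast, harmonicMonomial_natCast]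
    simp [mul_pow]
    ring
  · have := (hasSum_nat_add_iff' 1).2 hy
    simp only [Finset.range_one, Finset.sum_singleton, zero_add, Nat.choose_self, pow_zero,
      Nat.cast_one, mul_one] at this
    refine this.congr_fun fun n => ?_
    rw [harmonicMonomial_neg, harmonicMonomial_neg]
    have h1 : (-((n : ℤ) + 1)).natAbs = n + 1 := by omega
    rw [h1]
    simp [mul_pow]
    ring

lemma summable_weight {z : ℂ} (hz : z ∈ ball (0 : ℂ) 1) :
    Summable fun k : ℤ => ((k.natAbs : ℝ) + 1) * ‖z‖ ^ k.natAbs := by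
  have hx := summable_choose_mul_geometric_of_norm_lt_one (R := ℝ) 1 (r := ‖z‖)
    (by simpa using hz)
  refine Summable.of_nat_of_neg_add_one ?_ ?_
  · refine hx.congr fun n => ?_
    simp
  · refine ((summable_nat_add_iff 1).2 hx).congr fun n => ?_
    have h1 : (-((n : ℤ) + 1)).natAbs = n + 1 := by omega
    rw [h1]
    simp

/-- The expansion of `Q φ` in harmonic monomials. -/
lemma Q_hasHarmonicExpansion {φ : ℂ → ℂ} (hφ : Integrable φ diskMeasure) :
    HasHarmonicExpansion (Q φ) (fun k => ((k.natAbs : ℂ) + 1) *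
      ∫ w, conj (harmonicMonomial k w) * φ w ∂diskMeasure) := by
  intro z hz
  have h1 : HasSum (fun k : ℤ => ∫ w, ((k.natAbs : ℂ) + 1) * harmonicMonomial k z *
      (conj (harmonicMonomial k w) * φ w) ∂diskMeasure) (Q φ z) := by
    refine hasSum_integral_of_dominated_convergence
      (fun k w => ((k.natAbs : ℝ) + 1) * ‖z‖ ^ k.natAbs * ‖φ w‖) (fun k => ?_) (fun k => ?_)
      ?_ ?_ ?_
    · exact ((integrable_conj_harmonicMonomial_mul hφ k).const_mul _).aestronglyMeasurable
    · filter_upwards [ae_mem_ball] with w hw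
      rw [norm_mul, norm_mul, norm_mul, norm_harmonicMonomial, RCLike.norm_conj]
      have e : ‖(k.natAbs : ℂ) + 1‖ = (k.natAbs : ℝ) + 1 := by
        exact_mod_cast Complex.norm_natCast (k.natAbs + 1)
      rw [e]
      gcongr
      exact mul_le_of_le_one_left (norm_nonneg _) (norm_harmonicMonomial_le_one k hw)
    · exact Filter.Eventually.of_forall fun w => (summable_weight hz).mul_right _
    · simp_rw [tsum_mul_right]
      exact hφ.norm.const_mul _
    · filter_upwards [ae_mem_ball] with w hw
      refine ((kernel_hasSum hz hw).mul_right (φ w)).congr_fun fun k => ?_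
      ring
  refine h1.congr_fun fun k => ?_
  rw [integral_const_mul]
  ring

/-! ### The orthogonal basis of harmonic monomials. -/

lemma memLp_harmonicMonomial (k : ℤ) : MemLp (harmonicMonomial k) 2 diskMeasure :=
  MemLp.of_bound (continuous_harmonicMonomial k).aestronglyMeasurable 1
    (ae_mem_ball.mono fun _ hz => norm_harmonicMonomial_le_one k hz)

lemma harmonicMonomial_harmonicOnNhd (k : ℤ) :
    InnerProductSpace.HarmonicOnNhd (harmonicMonomial k) (ball (0 : ℂ) 1) := by
  rcases le_total 0 k with h | h
  · have e : harmonicMonomial k = fun z => z ^ k.toNat := by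
      ext z
      rw [harmonicMonomial, Int.toNat_eq_zero.2 (show -k ≤ 0 by omega), pow_zero, mul_one]
    rw [e]
    intro z _
    exact AnalyticAt.harmonicAt (by fun_prop)
  · have e : harmonicMonomial k = Complex.conjCLE.toContinuousLinearMap ∘
        fun z => z ^ (-k).toNat := by
      ext z
      rw [harmonicMonomial, Int.toNat_eq_zero.2 h, pow_zero, one_mul]
      simp
    rw [e]
    refine InnerProductSpace.HarmonicOnNhd.comp_CLM (fun z _ => ?_) _
    exact AnalyticAt.harmonicAt (by fun_prop)

/-- The harmonic monomials as elements of the harmonic Bergman space. -/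
def monomialL2h (k : ℤ) : L2h :=
  ⟨(memLp_harmonicMonomial k).toLp, harmonicMonomial k, harmonicMonomial_harmonicOnNhd k,
    (memLp_harmonicMonomial k).coeFn_toLp⟩

lemma coeFn_monomialL2h (k : ℤ) :
    (monomialL2h k : Lp ℂ 2 diskMeasure) =ᵐ[diskMeasure] harmonicMonomial k :=
  (memLp_harmonicMonomial k).coeFn_toLp

lemma integrable_of_ae_eq_L2 {h : Lp ℂ 2 diskMeasure} {F : ℂ → ℂ} (hF : h =ᵐ[diskMeasure] F) :
    Integrable F diskMeasure :=
  (((Lp.memLp h).integrable (by norm_num)).congr hF)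

lemma inner_monomialL2h {h : L2h} {F : ℂ → ℂ} {c : ℤ → ℂ}
    (hF : (h : Lp ℂ 2 diskMeasure) =ᵐ[diskMeasure] F) (hc : HasHarmonicExpansion F c) (k : ℤ) :
    inner ℂ (monomialL2h k) h = c k / ((k.natAbs : ℂ) + 1) := by
  rw [Submodule.coe_inner, L2.inner_def]
  have h1 : ∫ z, inner ℂ ((monomialL2h k : Lp ℂ 2 diskMeasure) z) ((h : Lp ℂ 2 diskMeasure) z)
      ∂diskMeasure = ∫ z, conj (harmonicMonomial k z) * F z ∂diskMeasure := by
    refine integral_congr_ae ?_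
    filter_upwards [hF, coeFn_monomialL2h k] with z h1 h2
    rw [h1, h2, RCLike.inner_apply, mul_comm]
  rw [h1, integral_conj_mul (integrable_of_ae_eq_L2 hF), hc.radialMoment_eq]
  have h2 : (k.natAbs : ℂ) + 1 ≠ 0 := Nat.cast_add_one_ne_zero _
  have h3 : (k.natAbs : ℂ) + k.natAbs + 2 = 2 * ((k.natAbs : ℂ) + 1) := by ring
  rw [h3]
  field_simp

lemma harmonicMonomial_hasHarmonicExpansion (k : ℤ) :
    HasHarmonicExpansion (harmonicMonomial k) (Pi.single k 1) := by
  intro z _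
  refine (hasSum_ite_eq k (harmonicMonomial k z)).congr_fun fun j => ?_
  by_cases hj : j = k
  · subst hj; simp
  · simp [hj]

lemma inner_monomialL2h_monomialL2h (j k : ℤ) :
    inner ℂ (monomialL2h j) (monomialL2h k) = if j = k then 1 / ((k.natAbs : ℂ) + 1) else 0 := by
  rw [inner_monomialL2h (coeFn_monomialL2h k) (harmonicMonomial_hasHarmonicExpansion k)]
  by_cases h : j = k
  · subst h; simp
  · simp [h]

lemma orthonormal_monomials : Orthonormal ℂ fun k : ℤ =>
    (Real.sqrt (k.natAbs + 1) : ℂ) • (monomialL2h k : Lp ℂ 2 diskMeasure) := by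
  rw [orthonormal_iff_ite]
  intro j k
  rw [inner_smul_left, inner_smul_right, ← Submodule.coe_inner, inner_monomialL2h_monomialL2h]
  split_ifs with h
  · subst h
    rw [Complex.conj_ofReal, ← mul_assoc, ← Complex.ofReal_mul,
      Real.mul_self_sqrt (by positivity)]
    push_cast
    have h2 : (j.natAbs : ℂ) + 1 ≠ 0 := Nat.cast_add_one_ne_zero _
    rw [mul_one_div]
    exact_mod_cast div_self h2
  · simp

/-- Bessel's inequality for the normalized monomials; the two factors √(|k|+1) multiply to the
weight |k|+1. -/
lemma summable_monomials (h : Lp ℂ 2 diskMeasure) : Summable fun k : ℤ =>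
    (((k.natAbs : ℂ) + 1) * inner ℂ (monomialL2h k : Lp ℂ 2 diskMeasure) h) •
      (monomialL2h k : Lp ℂ 2 diskMeasure) := by
  have h1 := (orthonormal_monomials.orthogonalFamily.summable_iff_norm_sq_summable _).2
    (orthonormal_monomials.inner_products_summable h)
  refine h1.congr fun k => ?_
  rw [LinearIsometry.toSpanSingleton_apply, inner_smul_left, smul_smul]
  congr 1
  have : ((Real.sqrt (k.natAbs + 1) : ℝ) : ℂ) * (Real.sqrt (k.natAbs + 1) : ℝ) =
      (k.natAbs : ℂ) + 1 := by
    rw [← Complex.ofReal_mul, Real.mul_self_sqrt (by positivity)]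
    push_cast
    rfl
  rw [Complex.conj_ofReal, ← this]
  ring

/-- The monomial expansion of an element of the harmonic Bergman space. -/
lemma hasSum_monomialL2h (h : L2h) : HasSum (fun k : ℤ =>
    (((k.natAbs : ℂ) + 1) * inner ℂ (monomialL2h k) h) • monomialL2h k) h := by
  obtain ⟨F, hF, hFe⟩ := h.2
  obtain ⟨c, hc⟩ := exists_hasHarmonicExpansion hF
  have hcoef : ∀ k : ℤ, ((k.natAbs : ℂ) + 1) * inner ℂ (monomialL2h k) h = c k := fun k => by
    have h2 : (k.natAbs : ℂ) + 1 ≠ 0 := Nat.cast_add_one_ne_zero _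
    rw [inner_monomialL2h hFe hc]
    field_simp
  have hs := (summable_monomials h).hasSum
  simp_rw [← Submodule.coe_inner, hcoef] at hs
  simp_rw [hcoef]
  set S := ∑' k : ℤ, c k • (monomialL2h k : Lp ℂ 2 diskMeasure)
  have hlim := hs.comp (Finset.tendsto_Icc_neg (R := ℤ))
  -- A subsequence of the L² partial sums converges almost everywhere, and the pointwise expansion
  -- of the harmonic representative identifies its limit. Completeness thus needs no separate
  -- density argument.
  obtain ⟨ns, hns, hae⟩ := (tendstoInMeasure_of_tendsto_Lp hlim).exists_seq_tendsto_ae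
  have hfin : ∀ s : Finset ℤ,
      (∑ k ∈ s, c k • (monomialL2h k : Lp ℂ 2 diskMeasure) : Lp ℂ 2 diskMeasure)
      =ᵐ[diskMeasure] fun z => ∑ k ∈ s, c k * harmonicMonomial k z := by
    intro s
    have h1 : ∀ᵐ z ∂diskMeasure, ∀ k : ℤ,
        (c k • (monomialL2h k : Lp ℂ 2 diskMeasure) : Lp ℂ 2 diskMeasure) z =
          c k * harmonicMonomial k z := by
      rw [ae_all_iff]
      intro k
      filter_upwards [Lp.coeFn_smul (c k) (monomialL2h k : Lp ℂ 2 diskMeasure),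
        coeFn_monomialL2h k] with z h1 h2
      rw [h1, Pi.smul_apply, h2, smul_eq_mul]
    filter_upwards [Lp.coeFn_finsetSum s
      (fun k => (c k • (monomialL2h k : Lp ℂ 2 diskMeasure) : Lp ℂ 2 diskMeasure)), h1]
      with z h2 h3
    rw [h2, Finset.sum_apply]
    exact Finset.sum_congr rfl fun k _ => h3 k
  have hall : ∀ᵐ z ∂diskMeasure, ∀ n : ℕ,
      (∑ k ∈ Finset.Icc (-(n : ℤ)) n, c k • (monomialL2h k : Lp ℂ 2 diskMeasure) :
        Lp ℂ 2 diskMeasure) z = ∑ k ∈ Finset.Icc (-(n : ℤ)) n, c k * harmonicMonomial k z :=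
    ae_all_iff.2 fun n => hfin _
  have hSh : S = h := by
    refine Lp.ext ?_
    filter_upwards [hae, hall, hFe, ae_mem_ball] with z h1 h2 h3 h4
    rw [h3]
    refine tendsto_nhds_unique h1 ?_
    have h5 := ((hc z h4).comp (Finset.tendsto_Icc_neg (R := ℤ))).comp hns.tendsto_atTop
    refine h5.congr fun i => ?_
    exact (h2 (ns i)).symm
  rw [hSh] at hs
  exact (Topology.IsInducing.hasSum_iff (g := L2h.subtype) ⟨rfl⟩ _ _).1 hs

/-! ### Matrices of operators. -/

/-- The matrix of a bounded operator on the harmonic Bergman space in the harmonic monomials. -/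
def entry (A : L2h →L[ℂ] L2h) (j k : ℤ) : ℂ := inner ℂ (monomialL2h j) (A (monomialL2h k))

/-- Matrix multiplication in an orthogonal system that is not normalized: the weight |m|+1 is
1/‖e_m‖². -/
lemma entry_comp (A B : L2h →L[ℂ] L2h) (j k : ℤ) :
    HasSum (fun m : ℤ => ((m.natAbs : ℂ) + 1) * entry A j m * entry B m k)
      (entry (A.comp B) j k) := by
  have h := ((hasSum_monomialL2h (B (monomialL2h k))).mapL A).mapL (innerSL ℂ (monomialL2h j))
  refine h.congr_fun fun m => ?_
  rw [map_smul, map_smul, innerSL_apply_apply, smul_eq_mul, entry, entry]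
  ring

lemma eq_of_entry_eq {A B : L2h →L[ℂ] L2h} (h : ∀ j k, entry A j k = entry B j k) : A = B := by
  have h1 : ∀ k, A (monomialL2h k) = B (monomialL2h k) := by
    intro k
    refine (hasSum_monomialL2h _).unique ((hasSum_monomialL2h _).congr_fun fun j => ?_)
    exact congrArg (fun x => (((j.natAbs : ℂ) + 1) * x) • monomialL2h j) (h j k)
  ext1 x
  have hA := (hasSum_monomialL2h x).mapL A
  have hB := (hasSum_monomialL2h x).mapL B
  simp_rw [map_smul, h1] at hA
  simp_rw [map_smul] at hB
  exact hA.unique hB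

lemma exists_harmonicPoly (k : ℤ) : ∃ p q : Polynomial ℂ, harmonicPoly p q = harmonicMonomial k := by
  rcases le_total 0 k with h | h
  · refine ⟨Polynomial.X ^ k.toNat, 0, ?_⟩
    ext z
    rw [harmonicMonomial, Int.toNat_eq_zero.2 (show -k ≤ 0 by omega)]
    simp [harmonicPoly]
  · refine ⟨0, Polynomial.X ^ (-k).toNat, ?_⟩
    ext z
    rw [harmonicMonomial, Int.toNat_eq_zero.2 h]
    simp [harmonicPoly]

/-- The matrix entries of a Toeplitz operator are radial moments of the polar coefficients of
its symbol. -/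
lemma IsToeplitz.entry_eq {f : ℂ → ℂ} {T : L2h →L[ℂ] L2h} (hT : IsToeplitz f T)
    (hf : Integrable f diskMeasure) (j k : ℤ) :
    entry T j k = radialMoment f (j - k) (j.natAbs + k.natAbs) := by
  obtain ⟨p, q, hpq⟩ := exists_harmonicPoly k
  have h1 := hT p q (monomialL2h k) (by rw [hpq]; exact coeFn_monomialL2h k)
  rw [hpq] at h1
  rw [entry, inner_monomialL2h h1 (Q_hasHarmonicExpansion (integrable_mul_harmonicMonomial hf k)),
    integral_conj_mul_mul hf]
  have h2 : (j.natAbs : ℂ) + 1 ≠ 0 := Nat.cast_add_one_ne_zero _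
  field_simp

/-! ### Uniqueness from vanishing moments. -/

/-- A function that annihilates a family of functions in which the continuous functions can be
approximated uniformly vanishes almost everywhere. -/
lemma ae_eq_zero_of_forall_approx {E : Type*} [NormedAddCommGroup E] [NormedSpace ℝ E]
    [FiniteDimensional ℝ E] [MeasurableSpace E] [BorelSpace E] {μ : Measure E} {U : Set E}
    (hU : IsOpen U) {φ : E → ℂ} (hφ : IntegrableOn φ U μ) (P : Set (E → ℂ))
    (hP : ∀ p ∈ P, Continuous p ∧ ∫ x in U, p x * φ x ∂μ = 0)
    (happ : ∀ g : E → ℝ, Continuous g → ∀ ε : ℝ, 0 < ε →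
      ∃ p ∈ P, ∀ x ∈ U, ‖p x - (g x : ℂ)‖ ≤ ε) :
    ∀ᵐ x ∂(μ.restrict U), φ x = 0 := by
  rw [ae_restrict_iff' hU.measurableSet]
  refine hU.ae_eq_zero_of_integral_contDiff_smul_eq_zero hφ.locallyIntegrableOn
    fun g hg hgc hgs => ?_
  have hg1 : ∫ x, g x • φ x ∂μ = ∫ x in U, (g x : ℂ) * φ x ∂μ := by
    simp_rw [Complex.real_smul]
    rw [setIntegral_eq_integral_of_forall_compl_eq_zero fun x hx => ?_]
    rw [image_eq_zero_of_notMem_tsupport fun h => hx (hgs h)]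
    simp
  obtain ⟨C, hC⟩ := hgc.exists_bound_of_continuous hg.continuous
  have hgi : Integrable (fun x => (g x : ℂ) * φ x) (μ.restrict U) :=
    hφ.bdd_mul (c := C) (Complex.continuous_ofReal.comp hg.continuous).aestronglyMeasurable
      (Filter.Eventually.of_forall fun x => by simpa using hC x)
  rw [hg1, ← norm_le_zero_iff]
  refine le_of_forall_pos_le_add fun δ hδ => ?_
  set I := ∫ x in U, ‖φ x‖ ∂μ
  have hI : 0 ≤ I := integral_nonneg fun _ => norm_nonneg _
  obtain ⟨p, hpP, hp⟩ := happ g hg.continuous (δ / (I + 1)) (by positivity)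
  obtain ⟨hpc, hp0⟩ := hP p hpP
  have hdi : Integrable (fun x => (p x - (g x : ℂ)) * φ x) (μ.restrict U) :=
    hφ.bdd_mul (c := δ / (I + 1))
      (hpc.sub (Complex.continuous_ofReal.comp hg.continuous)).aestronglyMeasurable
      ((ae_restrict_mem hU.measurableSet).mono hp)
  have hsum : ∫ x in U, p x * φ x ∂μ =
      ∫ x in U, (p x - (g x : ℂ)) * φ x ∂μ + ∫ x in U, (g x : ℂ) * φ x ∂μ := by
    rw [← integral_add hdi hgi]
    congr 1
    ext x
    ring
  have h2 : ∫ x in U, (g x : ℂ) * φ x ∂μ = -∫ x in U, (p x - (g x : ℂ)) * φ x ∂μ := by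
    rw [hp0] at hsum
    exact eq_neg_of_add_eq_zero_right hsum.symm
  rw [h2, norm_neg, zero_add]
  calc ‖∫ x in U, (p x - (g x : ℂ)) * φ x ∂μ‖ ≤ ∫ x in U, δ / (I + 1) * ‖φ x‖ ∂μ := by
        refine norm_integral_le_of_norm_le (hφ.norm.const_mul _) ?_
        filter_upwards [ae_restrict_mem hU.measurableSet] with x hx
        rw [norm_mul]
        exact mul_le_mul_of_nonneg_right (hp x hx) (norm_nonneg _)
    _ = δ / (I + 1) * I := integral_const_mul _ _
    _ ≤ δ := by
        rw [div_mul_eq_mul_div, div_le_iff₀ (by positivity)]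
        nlinarith

/-- An integrable function on `(0, 1)` whose even moments vanish is zero. -/
lemma ae_eq_zero_of_even_moments {φ : ℝ → ℂ} (hφ : IntegrableOn φ (Ioo (0 : ℝ) 1))
    (h : ∀ i : ℕ, ∫ r in Ioo (0 : ℝ) 1, (r : ℂ) ^ (2 * i) * φ r = 0) :
    ∀ᵐ r ∂(volume.restrict (Ioo (0 : ℝ) 1)), φ r = 0 := by
  refine ae_eq_zero_of_forall_approx isOpen_Ioo hφ
    (range fun (q : Polynomial ℝ) (r : ℝ) => ((q.eval (r ^ 2) : ℝ) : ℂ)) ?_ ?_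
  · rintro _ ⟨q, rfl⟩
    refine ⟨by fun_prop, ?_⟩
    have hi : ∀ i : ℕ, Integrable (fun r : ℝ => (q.coeff i : ℂ) * ((r : ℂ) ^ (2 * i) * φ r))
        (volume.restrict (Ioo (0 : ℝ) 1)) := by
      intro i
      refine Integrable.const_mul (hφ.bdd_mul (c := 1) (by fun_prop) ?_) _
      filter_upwards [ae_restrict_mem measurableSet_Ioo] with r hr
      rw [norm_pow, Complex.norm_real, Real.norm_of_nonneg hr.1.le]
      exact pow_le_one₀ hr.1.le hr.2.le
    have e : ∀ r : ℝ, ((q.eval (r ^ 2) : ℝ) : ℂ) * φ r =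
        ∑ i ∈ Finset.range (q.natDegree + 1), (q.coeff i : ℂ) * ((r : ℂ) ^ (2 * i) * φ r) := by
      intro r
      rw [Polynomial.eval_eq_sum_range]
      push_cast
      rw [Finset.sum_mul]
      refine Finset.sum_congr rfl fun i _ => ?_
      rw [pow_mul, mul_assoc]
    simp_rw [e]
    rw [integral_finsetSum _ fun i _ => hi i]
    refine Finset.sum_eq_zero fun i _ => ?_
    rw [integral_const_mul, h, mul_zero]
  · intro g hg ε hε
    -- Approximating x ↦ g(√x) and putting x = r² gives a polynomial in even powers only.
    obtain ⟨q, hq⟩ := exists_polynomial_near_of_continuousOn 0 1 (fun x => g (Real.sqrt x))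
      (by fun_prop) ε hε
    refine ⟨_, ⟨q, rfl⟩, fun r hr => ?_⟩
    have h1 := hq (r ^ 2) ⟨by positivity, pow_le_one₀ hr.1.le hr.2.le⟩
    simp only [Real.sqrt_sq hr.1.le] at h1
    rw [← Complex.ofReal_sub, Complex.norm_real, Real.norm_eq_abs]
    exact h1.le

/-- Shows that polynomials in z and conj z are closed under conjugation, as the star case of the
adjoined algebra requires. -/
lemma conj_eval_conj (q : MvPolynomial (Fin 2) ℂ) (z : ℂ) :
    conj (MvPolynomial.eval ![z, conj z] q) = MvPolynomial.eval ![z, conj z]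
      (MvPolynomial.rename (Equiv.swap 0 1) (MvPolynomial.map (starRingEnd ℂ) q)) := by
  rw [MvPolynomial.eval_rename, MvPolynomial.eval_map, ← MvPolynomial.eval₂_id,
    MvPolynomial.hom_eval₂, RingHom.comp_id]
  congr 1
  ext i
  fin_cases i <;> simp

/-- Continuous functions on the disk are uniform limits of polynomials in `z` and `conj z`. -/
lemma exists_mvPolynomial_near {g : ℂ → ℂ} (hg : Continuous g) {ε : ℝ} (hε : 0 < ε) :
    ∃ q : MvPolynomial (Fin 2) ℂ, ∀ z ∈ ball (0 : ℂ) 1,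
      ‖MvPolynomial.eval ![z, conj z] q - g z‖ ≤ ε := by
  set K := closedBall (0 : ℂ) 1
  have : CompactSpace K := isCompact_iff_compactSpace.1 (isCompact_closedBall 0 1)
  set X : C(K, ℂ) := ⟨fun z => (z : ℂ), continuous_subtype_val⟩
  set A := StarAlgebra.adjoin ℂ ({X} : Set C(K, ℂ))
  have hA : A.topologicalClosure = ⊤ := by
    refine ContinuousMap.starSubalgebra_topologicalClosure_eq_top_of_separatesPoints A ?_
    intro x y hxy
    -- The coordinate function alone separates points.
    exact ⟨X, ⟨X, StarAlgebra.subset_adjoin ℂ _ rfl, rfl⟩, fun h => hxy (Subtype.ext h)⟩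
  set G : C(K, ℂ) := ⟨fun z => g z, hg.comp continuous_subtype_val⟩
  have hG : G ∈ closure (A : Set C(K, ℂ)) := by
    have : G ∈ A.topologicalClosure := hA ▸ trivial
    exact this
  obtain ⟨p, hpA, hp⟩ := Metric.mem_closure_iff.1 hG ε hε
  have hrep : ∀ p ∈ A, ∃ q : MvPolynomial (Fin 2) ℂ, ∀ z : K,
      p z = MvPolynomial.eval ![(z : ℂ), conj (z : ℂ)] q := by
    intro p hp
    induction hp using StarAlgebra.adjoin_induction with
    | mem x hx =>
      refine ⟨MvPolynomial.X 0, fun z => ?_⟩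
      rw [mem_singleton_iff.1 hx]
      simp [X]
    | algebraMap c => exact ⟨MvPolynomial.C c, fun z => by simp⟩
    | add x y _ _ hx hy =>
      obtain ⟨q, hq⟩ := hx
      obtain ⟨q', hq'⟩ := hy
      exact ⟨q + q', fun z => by simp [hq, hq']⟩
    | mul x y _ _ hx hy =>
      obtain ⟨q, hq⟩ := hx
      obtain ⟨q', hq'⟩ := hy
      exact ⟨q * q', fun z => by simp [hq, hq']⟩
    | star x _ hx =>
      obtain ⟨q, hq⟩ := hx
      exact ⟨_, fun z => by rw [← conj_eval_conj, ← hq]; rfl⟩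
  obtain ⟨q, hq⟩ := hrep p hpA
  refine ⟨q, fun z hz => ?_⟩
  rw [← hq ⟨z, ball_subset_closedBall hz⟩, ← dist_eq_norm, dist_comm]
  exact (ContinuousMap.dist_apply_le_dist (f := G) (g := p)
    ⟨z, ball_subset_closedBall hz⟩).trans hp.le

/-- An integrable function on the disk is determined by its radial moments. -/
lemma ae_eq_zero_of_radialMoment {f : ℂ → ℂ} (hf : Integrable f diskMeasure)
    (h : ∀ n s, radialMoment f n s = 0) : ∀ᵐ z ∂diskMeasure, f z = 0 := by
  rw [ae_diskMeasure_iff]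
  have hmon : ∀ a b : ℕ, ∫ z in ball (0 : ℂ) 1, z ^ a * conj z ^ b * f z = 0 := by
    intro a b
    have h1 := integral_conj_mul_mul hf b a
    rw [h, integral_diskMeasure] at h1
    have h2 : (1 / Real.pi : ℂ) ≠ 0 := by simp [Real.pi_ne_zero]
    refine Eq.trans ?_ ((mul_eq_zero.1 h1).resolve_left h2)
    congr 1
    ext z
    rw [harmonicMonomial_natCast, harmonicMonomial_natCast, map_pow]
    ring
  have hint := integrable_diskMeasure_iff.1 hf
  refine ae_eq_zero_of_forall_approx isOpen_ball hint
    (range fun (q : MvPolynomial (Fin 2) ℂ) (z : ℂ) => MvPolynomial.eval ![z, conj z] q) ?_ ?_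
  · rintro _ ⟨q, rfl⟩
    have e : ∀ z : ℂ, MvPolynomial.eval ![z, conj z] q =
        ∑ d ∈ q.support, q.coeff d * (z ^ d 0 * conj z ^ d 1) := by
      intro z
      rw [MvPolynomial.eval_eq']
      simp
    simp only [e]
    refine ⟨by fun_prop, ?_⟩
    have hi : ∀ d : Fin 2 →₀ ℕ, Integrable
        (fun z : ℂ => q.coeff d * (z ^ d 0 * conj z ^ d 1 * f z))
        (volume.restrict (ball (0 : ℂ) 1)) := by
      intro d
      refine Integrable.const_mul (hint.bdd_mul (c := 1)
        (Continuous.aestronglyMeasurable (by fun_prop)) ?_) _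
      filter_upwards [ae_restrict_mem measurableSet_ball] with z hz
      rw [norm_mul, norm_pow, norm_pow, RCLike.norm_conj, ← pow_add]
      exact pow_le_one₀ (norm_nonneg _) (mem_ball_zero_iff.1 hz).le
    simp_rw [Finset.sum_mul, mul_assoc (q.coeff _)]
    rw [integral_finsetSum _ fun d _ => hi d]
    refine Finset.sum_eq_zero fun d _ => ?_
    rw [integral_const_mul, hmon, mul_zero]
  · intro g hg ε hε
    obtain ⟨q, hq⟩ := exists_mvPolynomial_near (Complex.continuous_ofReal.comp hg) hε
    exact ⟨_, ⟨q, rfl⟩, hq⟩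

/-! ### Operators with a symbol. -/

/-- The bounded operator `A` has the matrix of the Toeplitz operator with integrable
symbol `f`. -/
structure HasSymbol (A : L2h →L[ℂ] L2h) (f : ℂ → ℂ) : Prop where
  integrable : Integrable f diskMeasure
  entry_eq : ∀ j k, entry A j k = radialMoment f (j - k) (j.natAbs + k.natAbs)

lemma entry_sub_smul (A B : L2h →L[ℂ] L2h) (c : ℂ) (j k : ℤ) :
    entry (A - c • B) j k = entry A j k - c * entry B j k := by
  have h : inner ℂ (monomialL2h j) (c • B (monomialL2h k)) =
      c * inner ℂ (monomialL2h j) (B (monomialL2h k)) :=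
    (innerSL ℂ (monomialL2h j)).map_smul c (B (monomialL2h k))
  simp only [entry, sub_apply, smul_apply, inner_sub_right, h]

/-- This allows multiples of u and 1 to be removed from operator and symbol at the same time. -/
lemma HasSymbol.sub_smul {A B : L2h →L[ℂ] L2h} {f g : ℂ → ℂ} (hA : HasSymbol A f)
    (hB : HasSymbol B g) (c : ℂ) : HasSymbol (A - c • B) (fun z => f z - c * g z) where
  integrable := hA.integrable.sub (hB.integrable.const_mul c)
  entry_eq j k := by
    rw [entry_sub_smul, hA.entry_eq, hB.entry_eq, radialMoment_sub hA.integrable hB.integrable]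

lemma hasSymbol_id : HasSymbol (ContinuousLinearMap.id ℂ L2h) (harmonicMonomial 0) where
  integrable := (memLp_harmonicMonomial 0).integrable (by norm_num)
  entry_eq j k := by
    rw [(harmonicMonomial_hasHarmonicExpansion 0).radialMoment_eq, entry,
      ContinuousLinearMap.id_apply, inner_monomialL2h_monomialL2h]
    by_cases h : j = k
    · subst h
      have h2 : (j.natAbs : ℂ) + 1 ≠ 0 := Nat.cast_add_one_ne_zero _
      have h3 : ((j.natAbs + j.natAbs : ℕ) : ℂ) + (0 : ℕ) + 2 = 2 * ((j.natAbs : ℂ) + 1) := by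
        push_cast; ring
      simp only [sub_self, Pi.single_eq_same, Int.natAbs_zero, if_true]
      rw [h3]
      field_simp
    · simp [h, sub_eq_zero]

lemma PolarCoeffZero.sub_smul {f g : ℂ → ℂ} {n : ℤ} (hf : Integrable f diskMeasure)
    (hg : Integrable g diskMeasure) (c : ℂ)
    (h : ∀ᵐ r : ℝ ∂(volume.restrict (Ioo (0 : ℝ) 1)), polarCoeff f n r = c * polarCoeff g n r) :
    PolarCoeffZero (fun z => f z - c * g z) n := by
  filter_upwards [ae_polarCoeff_sub hf hg c, h] with r h1 h2
  rw [h1, h2, sub_self]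

lemma TruncatedAbove.of_zero {f : ℂ → ℂ} {N : ℤ} (h : TruncatedAbove f N)
    (h0 : PolarCoeffZero f N) : TruncatedAbove f (N - 1) := by
  intro n hn
  rcases eq_or_ne n N with rfl | hne
  · exact h0
  · exact h n (by omega)

/-- The hypotheses on the harmonic symbol `u = z + conj g` and on its Toeplitz operator. -/
structure IsShiftSymbol (B : L2h →L[ℂ] L2h) (u : ℂ → ℂ) (c : ℤ → ℂ) : Prop where
  hasSymbol : HasSymbol B u
  expansion : HasHarmonicExpansion u c
  one : c 1 = 1
  zero : c 0 = 0
  of_one_lt : ∀ n, 1 < n → c n = 0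

lemma IsShiftSymbol.entry_eq {B : L2h →L[ℂ] L2h} {u : ℂ → ℂ} {c : ℤ → ℂ}
    (h : IsShiftSymbol B u c) (j k : ℤ) :
    entry B j k = 2 * c (j - k) / ((j.natAbs + k.natAbs : ℕ) + (j - k).natAbs + 2) := by
  rw [h.hasSymbol.entry_eq, h.expansion.radialMoment_eq]

/-! ### The leading polar coefficient. -/

section Commuting

variable {A B : L2h →L[ℂ] L2h} {f u : ℂ → ℂ} {c : ℤ → ℂ}

/-- The leading polar coefficient of a symbol truncated above commutes with `z`. -/
lemma radialMoment_recurrence (hA : HasSymbol A f) (hB : IsShiftSymbol B u c)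
    (hAB : A.comp B = B.comp A) {N : ℤ} (hN : TruncatedAbove f N) (k : ℤ) :
    ((k + 1).natAbs + 1 : ℂ) * radialMoment f N ((k + N + 1).natAbs + (k + 1).natAbs) *
      (2 / (((k + 1).natAbs + k.natAbs : ℕ) + 3)) =
    ((k + N).natAbs + 1 : ℂ) * (2 / (((k + N + 1).natAbs + (k + N).natAbs : ℕ) + 3)) *
      radialMoment f N ((k + N).natAbs + k.natAbs) := by
  have hA0 : ∀ j m, N < j - m → entry A j m = 0 := fun j m h => by
    rw [hA.entry_eq, (hN _ h).radialMoment_eq_zero]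
  have hB0 : ∀ j m, 1 < j - m → entry B j m = 0 := fun j m h => by
    rw [hB.entry_eq, hB.of_one_lt _ h]
    simp
  have hB1 : ∀ m, entry B (m + 1) m = 2 / (((m + 1).natAbs + m.natAbs : ℕ) + 3) := fun m => by
    rw [hB.entry_eq, add_sub_cancel_left, hB.one]
    push_cast
    ring_nf
  -- The diagonal N + 1 is the highest that either product can reach, with N steps from A and 1 from
  -- B. So only m = k + 1 survives in AB, and only m = k + N in BA.
  have h1 := (entry_comp A B (k + N + 1) k).unique
    (hasSum_single (k + 1) fun m hm => by
      rcases lt_or_gt_of_ne hm with h | h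
      · rw [hA0 _ _ (by omega)]; ring
      · rw [hB0 _ _ (by omega)]; ring)
  have h2 := (entry_comp B A (k + N + 1) k).unique
    (hasSum_single (k + N) fun m hm => by
      rcases lt_or_gt_of_ne hm with h | h
      · rw [hB0 _ _ (by omega)]; ring
      · rw [hA0 _ _ (by omega)]; ring)
  rw [hAB, h2, hB1, hB1, hA.entry_eq, hA.entry_eq] at h1
  rw [show k + N - k = N by ring, show k + N + 1 - (k + 1) = N by ring] at h1
  exact h1.symm

/-- The leading polar coefficient of a symbol truncated above is a multiple of `r ^ N`. -/
lemma exists_polarCoeff_eq_zpow (hA : HasSymbol A f) (hB : IsShiftSymbol B u c)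
    (hAB : A.comp B = B.comp A) {N : ℤ} (hN : TruncatedAbove f N) :
    ∃ D : ℂ, ∀ᵐ r : ℝ ∂(volume.restrict (Ioo (0 : ℝ) 1)),
      polarCoeff f N r = D * (r : ℂ) ^ N := by
  -- K and M are the negative and positive parts of N. Using k = K + i keeps both k and k + N = M +
  -- i nonnegative, so every absolute value is explicit.
  obtain ⟨K, M, rfl⟩ : ∃ K M : ℕ, N = M - K :=
    ⟨(-N).toNat, N.toNat, by omega⟩
  set m := radialMoment f ((M : ℤ) - K)
  have hrec : ∀ i : ℕ, ((i + 1 + M : ℕ) + 1 : ℂ) * m (2 * (i + 1) + K + M) =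
      ((i + M : ℕ) + 1 : ℂ) * m (2 * i + K + M) := by
    intro i
    have h := radialMoment_recurrence hA hB hAB hN ((K : ℤ) + i)
    have e1 : ((K : ℤ) + i + 1).natAbs = K + i + 1 := by omega
    have e2 : ((K : ℤ) + i).natAbs = K + i := by omega
    have e3 : ((K : ℤ) + i + (M - K) + 1).natAbs = M + i + 1 := by omega
    have e4 : ((K : ℤ) + i + (M - K)).natAbs = M + i := by omega
    rw [e1, e2, e3, e4, show M + i + 1 + (K + i + 1) = 2 * (i + 1) + K + M by ring,
      show M + i + (K + i) = 2 * i + K + M by ring] at h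
    have h5 : (((K + i + 1 + (K + i) : ℕ) : ℂ) + 3) = 2 * ((K + i + 1 : ℕ) + 1) := by
      push_cast; ring
    have h6 : (((M + i + 1 + (M + i) : ℕ) : ℂ) + 3) = 2 * ((M + i + 1 : ℕ) + 1) := by
      push_cast; ring
    rw [h5, h6] at h
    have h7 : ((K + i + 1 : ℕ) + 1 : ℂ) ≠ 0 := Nat.cast_add_one_ne_zero _
    have h8 : ((M + i + 1 : ℕ) + 1 : ℂ) ≠ 0 := Nat.cast_add_one_ne_zero _
    rw [show i + 1 + M = M + i + 1 by ring, show i + M = M + i by ring]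
    field_simp at h
    linear_combination h
  -- The function D r^N has moment D/(M+1) at s = K + M, which dictates this D.
  set D := ((M : ℕ) + 1 : ℂ) * m (K + M)
  have hD : ∀ i : ℕ, ((i + M : ℕ) + 1 : ℂ) * m (2 * i + K + M) = D := by
    intro i
    induction i with
    | zero => simp [D]
    | succ i ih => rw [hrec, ih]
  have hint := integrableOn_pow_mul_polarCoeff hA.integrable ((M : ℤ) - K)
  have hpow : ∀ t : ℕ, IntegrableOn (fun r : ℝ => D * (r : ℂ) ^ t) (Ioo (0 : ℝ) 1) := fun t =>
    (Continuous.integrableOn_Icc (by fun_prop)).mono_set Ioo_subset_Icc_self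
  -- The known moments are spaced by 2, hence even moments after factoring out r^(K+M+1); the same
  -- factor turns r^N into r^(2M+1).
  have hzero := ae_eq_zero_of_even_moments
    (φ := fun r => (r : ℂ) ^ (K + M + 1) * polarCoeff f ((M : ℤ) - K) r -
      D * (r : ℂ) ^ (2 * M + 1)) ((hint (K + M)).sub (hpow (2 * M + 1))) fun i => by
    have e : ∀ r : ℝ, (r : ℂ) ^ (2 * i) * ((r : ℂ) ^ (K + M + 1) *
        polarCoeff f ((M : ℤ) - K) r - D * (r : ℂ) ^ (2 * M + 1)) =
        (r : ℂ) ^ (2 * i + K + M + 1) * polarCoeff f ((M : ℤ) - K) r -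
        D * (r : ℂ) ^ (2 * i + 2 * M + 1) := fun r => by ring
    simp_rw [e]
    rw [integral_sub (hint (2 * i + K + M)) (hpow _), integral_const_mul, integral_Ioo_pow,
      sub_eq_zero]
    have h1 : m (2 * i + K + M) = 2 * ∫ r in Ioo (0 : ℝ) 1,
      (r : ℂ) ^ (2 * i + K + M + 1) * polarCoeff f ((M : ℤ) - K) r := rfl
    have h2 := hD i
    have h3 : ((i + M : ℕ) + 1 : ℂ) ≠ 0 := Nat.cast_add_one_ne_zero _
    have h4 : ((2 * i + 2 * M + 1 : ℕ) + 1 : ℂ) = 2 * ((i + M : ℕ) + 1 : ℂ) := by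
      push_cast; ring
    rw [h4, ← h2, h1]
    field_simp
  refine ⟨D, ?_⟩
  filter_upwards [hzero, ae_restrict_mem measurableSet_Ioo] with r hr h0
  have hr0 : (r : ℂ) ≠ 0 := by exact_mod_cast h0.1.ne'
  have h1 : (r : ℂ) ^ (K + M + 1) * polarCoeff f ((M : ℤ) - K) r =
      (r : ℂ) ^ (K + M + 1) * (D * (r : ℂ) ^ ((M : ℤ) - K)) := by
    rw [sub_eq_zero.1 hr, mul_left_comm, ← zpow_natCast, ← zpow_natCast, ← zpow_add₀ hr0]
    congr 2
    push_cast
    ring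
  exact mul_left_cancel₀ (pow_ne_zero _ hr0) h1

/-- At k = -1 the recurrence for D r^N reads D/2 = D·N/(N+1) up to a common nonzero factor, which
for N ≠ 1 forces D = 0. -/
lemma polarCoeffZero_of_two_le (hA : HasSymbol A f) (hB : IsShiftSymbol B u c)
    (hAB : A.comp B = B.comp A) {N : ℤ} (hN : TruncatedAbove f N) (h2 : 2 ≤ N) :
    PolarCoeffZero f N := by
  obtain ⟨D, hD⟩ := exists_polarCoeff_eq_zpow hA hB hAB hN
  obtain ⟨n, rfl⟩ : ∃ n : ℕ, N = n + 2 := ⟨(N - 2).toNat, by omega⟩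
  have h := radialMoment_recurrence hA hB hAB hN (-1)
  have e1 : (-1 + ((n : ℤ) + 2) + 1).natAbs = n + 2 := by omega
  have e2 : (-1 + ((n : ℤ) + 2)).natAbs = n + 1 := by omega
  rw [e1, e2] at h
  simp only [neg_add_cancel, Int.natAbs_zero, Int.natAbs_neg, Int.natAbs_one] at h
  rw [add_zero, show n + 1 + 1 = n + 2 by ring,
    radialMoment_of_pow hD (n + 2) (by positivity)] at h
  have h3 : ((n + 2 : ℕ) : ℂ) + ((n : ℤ) + 2 : ℤ) + 2 = 2 * ((n + 2 : ℕ) + 1) := by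
    push_cast; ring
  have h4 : ((n + 2 + (n + 1) : ℕ) : ℂ) + 3 = 2 * ((n + 2 : ℕ) + 1) := by push_cast; ring
  have h5 : ((n + 2 : ℕ) + 1 : ℂ) ≠ 0 := Nat.cast_add_one_ne_zero _
  have h6 : ((n : ℕ) + 1 : ℂ) ≠ 0 := Nat.cast_add_one_ne_zero _
  rw [h3, h4] at h
  field_simp at h
  push_cast at h
  have h7 : D * ((n : ℂ) + 1) = 0 := by linear_combination (-1 / 2 : ℂ) * h
  have hD0 : D = 0 := (mul_eq_zero.1 h7).resolve_right h6
  filter_upwards [hD] with r hr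
  rw [hr, hD0, zero_mul]

end Commuting

/-! ### Excluding negative leading indices. -/

/-- A multiple of `r ^ n` with `n ≤ -2` that belongs to `L¹((0, 1), r dr)` vanishes. -/
lemma polarCoeffZero_of_le_neg_two {f : ℂ → ℂ} (hf : Integrable f diskMeasure) {N : ℤ}
    {D : ℂ} (hN : N ≤ -2)
    (hD : ∀ᵐ r : ℝ ∂(volume.restrict (Ioo (0 : ℝ) 1)), polarCoeff f N r = D * (r : ℂ) ^ N) :
    PolarCoeffZero f N := by
  suffices h : D = 0 by
    filter_upwards [hD] with r hr
    rw [hr, h, zero_mul]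
  by_contra hD0
  have h1 : IntegrableOn (fun r : ℝ => r ^ ((N : ℝ) + 1)) (Ioo (0 : ℝ) 1) := by
    refine ((integrableOn_mul_polarCoeff hf N).norm.const_mul ‖D‖⁻¹).congr ?_
    filter_upwards [hD, ae_restrict_mem measurableSet_Ioo] with r hr h0
    have h2 : ‖D‖ ≠ 0 := norm_ne_zero_iff.2 hD0
    simp only [hr, norm_mul, norm_zpow, Complex.norm_real, Real.norm_of_nonneg h0.1.le]
    rw [Real.rpow_add h0.1, Real.rpow_one, Real.rpow_intCast]
    field_simp
  rw [intervalIntegral.integrableOn_Ioo_rpow_iff one_pos] at h1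
  have : (N : ℝ) ≤ -2 := by exact_mod_cast hN
  linarith

/-- Bessel's inequality for a single polar coefficient. -/
lemma ae_sq_polarCoeff_le {f : ℂ → ℂ} (hf : MemLp f 2 diskMeasure) (n : ℤ) :
    ∀ᵐ r : ℝ ∂(volume.restrict (Ioo (0 : ℝ) 1)),
      ‖polarCoeff f n r‖ ^ 2 ≤ ‖polarCoeff (fun z => ((‖f z‖ ^ 2 : ℝ) : ℂ)) 0 r‖ := by
  have hfi : Integrable f diskMeasure := hf.integrable (by norm_num)
  have hf2 : Integrable (fun z => ((‖f z‖ ^ 2 : ℝ) : ℂ)) diskMeasure :=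
    ((memLp_two_iff_integrable_sq_norm hf.1).1 hf).ofReal
  filter_upwards [ae_integrableOn_circle hfi, ae_integrableOn_circle hf2] with r h1 h2
  set F : ℝ → ℂ := fun θ => f (r * Complex.exp (θ * Complex.I))
  have hpi : (0 : ℝ) < 2 * Real.pi := by positivity
  have hle : -Real.pi ≤ Real.pi := by linarith [Real.pi_pos]
  set t := ‖polarCoeff f n r‖
  have ht : 2 * Real.pi * t ≤ ∫ θ in (-Real.pi)..Real.pi, ‖F θ‖ := by
    have e : t = 1 / (2 * Real.pi) * ‖∫ θ in (-Real.pi)..Real.pi,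
        F θ * Complex.exp (-(n * θ * Complex.I))‖ := by
      simp only [t, polarCoeff, norm_mul, norm_div, norm_one, Complex.norm_ofNat,
        Complex.norm_real, Real.norm_of_nonneg Real.pi_pos.le, F]
    rw [e, ← mul_assoc, mul_one_div_cancel hpi.ne', one_mul]
    refine (intervalIntegral.norm_integral_le_integral_norm hle).trans_eq ?_
    refine intervalIntegral.integral_congr fun θ _ => ?_
    have e2 : -((n : ℂ) * θ * Complex.I) = ((-(n * θ) : ℝ) : ℂ) * Complex.I := by
      push_cast; ring
    simp only [norm_mul, e2, Complex.norm_exp_ofReal_mul_I, mul_one]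
  have h2' : IntervalIntegrable (fun θ => ‖F θ‖ ^ 2) volume (-Real.pi) Real.pi := by
    refine h2.norm.congr fun θ _ => ?_
    simp [F]
  -- Integrating 2t‖F‖ ≤ ‖F‖² + t² with t the norm of the coefficient, and using 2πt ≤ ∫‖F‖, gives
  -- 2πt² ≤ ∫‖F‖².
  have hmono : ∫ θ in (-Real.pi)..Real.pi, 2 * t * ‖F θ‖ ≤
      ∫ θ in (-Real.pi)..Real.pi, (‖F θ‖ ^ 2 + t ^ 2) := by
    refine intervalIntegral.integral_mono_on hle (h1.norm.const_mul _)
      (h2'.add intervalIntegrable_const) fun θ _ => ?_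
    nlinarith [sq_nonneg (‖F θ‖ - t)]
  rw [intervalIntegral.integral_const_mul, intervalIntegral.integral_add h2'
    intervalIntegrable_const, intervalIntegral.integral_const, smul_eq_mul] at hmono
  have hq : ‖polarCoeff (fun z => ((‖f z‖ ^ 2 : ℝ) : ℂ)) 0 r‖ =
      1 / (2 * Real.pi) * ∫ θ in (-Real.pi)..Real.pi, ‖F θ‖ ^ 2 := by
    have e3 : polarCoeff (fun z => ((‖f z‖ ^ 2 : ℝ) : ℂ)) 0 r =
        ((1 / (2 * Real.pi) * ∫ θ in (-Real.pi)..Real.pi, ‖F θ‖ ^ 2 : ℝ) : ℂ) := by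
      simp only [polarCoeff, Int.cast_zero, zero_mul, neg_zero, Complex.exp_zero, mul_one,
        intervalIntegral.integral_ofReal, F]
      push_cast
      rfl
    rw [e3, Complex.norm_real, Real.norm_of_nonneg]
    have : 0 ≤ ∫ θ in (-Real.pi)..Real.pi, ‖F θ‖ ^ 2 :=
      intervalIntegral.integral_nonneg hle fun θ _ => by positivity
    positivity
  rw [hq, one_div, ← div_eq_inv_mul, le_div_iff₀ hpi]
  have ht0 : 0 ≤ t := norm_nonneg _
  nlinarith [mul_le_mul_of_nonneg_left ht ht0]

/-- A multiple of `1 / r` that is the polar coefficient of a function in `L²` vanishes. -/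
lemma polarCoeffZero_neg_one_of_memLp {f : ℂ → ℂ} (hf : MemLp f 2 diskMeasure) {D : ℂ}
    (hD : ∀ᵐ r : ℝ ∂(volume.restrict (Ioo (0 : ℝ) 1)),
      polarCoeff f (-1) r = D * (r : ℂ) ^ (-1 : ℤ)) :
    PolarCoeffZero f (-1) := by
  suffices h : D = 0 by
    filter_upwards [hD] with r hr
    rw [hr, h, zero_mul]
  by_contra hD0
  have hf2 : Integrable (fun z => ((‖f z‖ ^ 2 : ℝ) : ℂ)) diskMeasure :=
    ((memLp_two_iff_integrable_sq_norm hf.1).1 hf).ofReal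
  have h2 : 0 < ‖D‖ := norm_pos_iff.2 hD0
  have h1 : IntegrableOn (fun r : ℝ => r ^ (-1 : ℝ)) (Ioo (0 : ℝ) 1) := by
    refine ((integrableOn_mul_polarCoeff_zero hf2).norm.const_mul (‖D‖ ^ 2)⁻¹).mono' ?_ ?_
    · exact (measurable_id.pow_const _).aestronglyMeasurable
    · filter_upwards [hD, ae_restrict_mem measurableSet_Ioo, ae_sq_polarCoeff_le hf (-1)]
        with r hr h0 hle
      have h3 : 0 < r := h0.1
      rw [hr, norm_mul, zpow_neg_one, norm_inv, Complex.norm_real,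
        Real.norm_of_nonneg h3.le] at hle
      rw [Real.rpow_neg_one, Real.norm_of_nonneg (by positivity), norm_mul, Complex.norm_real,
        Real.norm_of_nonneg h3.le]
      calc r⁻¹ = (‖D‖ ^ 2)⁻¹ * (r * (‖D‖ * r⁻¹) ^ 2) := by field_simp
        _ ≤ _ := by gcongr
  rw [intervalIntegral.integrableOn_Ioo_rpow_iff one_pos] at h1
  exact lt_irrefl _ h1

section Commuting

variable {A B : L2h →L[ℂ] L2h} {f u : ℂ → ℂ} {c : ℤ → ℂ}

/-- If `u` is not analytic, then a symbol truncated above at `-1` whose Toeplitz operator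
commutes with `T_u` has no polar coefficient of index `-1`. -/
lemma polarCoeffZero_neg_one_of_ne_zero (hA : HasSymbol A f) (hB : IsShiftSymbol B u c)
    (hAB : A.comp B = B.comp A) (hN : TruncatedAbove f (-1)) {l : ℕ} (hl : 1 ≤ l)
    (hc : c (-l) ≠ 0) (hmin : ∀ i : ℕ, 1 ≤ i → i < l → c (-i) = 0) : PolarCoeffZero f (-1) := by
  obtain ⟨D, hD⟩ := exists_polarCoeff_eq_zpow hA hB hAB hN
  have hc0 : ∀ n : ℤ, -(l : ℤ) < n → n ≠ 1 → c n = 0 := by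
    intro n h1 h2
    rcases lt_trichotomy n 0 with h | rfl | h
    · have := hmin n.natAbs (by omega) (by omega)
      rwa [show -(n.natAbs : ℤ) = n by omega] at this
    · exact hB.zero
    · exact hB.of_one_lt n (by omega)
  have hA0 : ∀ j m, -1 < j - m → entry A j m = 0 := fun j m h => by
    rw [hA.entry_eq, (hN _ h).radialMoment_eq_zero]
  have hB0 : ∀ j m, c (j - m) = 0 → entry B j m = 0 := fun j m h => by
    rw [hB.entry_eq, h]
    simp
  -- In the entry (-l-1, 0) two intermediate indices survive in each product. The terms from m = 1
  -- in AB and m = -l-2 in BA contain the unknown moment of f_{-l-2}, and they cancel because both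
  -- total weights are 1.
  have h1 := (entry_comp A B (-(l : ℤ) - 1) 0).unique
    (hasSum_sum_of_ne_finset_zero (s := {1, -(l : ℤ)}) fun m hm => by
      simp only [Finset.mem_insert, Finset.mem_singleton, not_or] at hm
      by_cases h : -(l : ℤ) < m
      · rw [hB0 m 0 (by rw [sub_zero]; exact hc0 m h hm.1)]; ring
      · rw [hA0 _ _ (by omega)]; ring)
  have h2 := (entry_comp B A (-(l : ℤ) - 1) 0).unique
    (hasSum_sum_of_ne_finset_zero (s := {-(l : ℤ) - 2, -1}) fun m hm => by
      simp only [Finset.mem_insert, Finset.mem_singleton, not_or] at hm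
      by_cases h : m ≤ -1
      · rw [hB0 _ m (hc0 _ (by omega) (by omega))]; ring
      · rw [hA0 _ _ (by omega)]; ring)
  rw [Finset.sum_pair (by omega)] at h1 h2
  rw [hAB, h2] at h1
  have hl1 : (-(l : ℤ) - 1).natAbs = l + 1 := by omega
  have hl2 : (-(l : ℤ) - 2).natAbs = l + 2 := by omega
  simp only [hA.entry_eq, hB.entry_eq] at h1
  rw [show -(l : ℤ) - 1 - (-(l : ℤ) - 2) = 1 by ring, show -(l : ℤ) - 1 - -1 = -l by ring,
    show -(l : ℤ) - 1 - 1 = -l - 2 by ring, show -(l : ℤ) - 1 - -(l : ℤ) = -1 by ring,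
    sub_zero, sub_zero, sub_zero, sub_zero, hB.one, hl1, hl2] at h1
  simp only [Int.natAbs_neg, Int.natAbs_one, Int.natAbs_natCast, Int.natAbs_zero, add_zero] at h1
  rw [radialMoment_of_pow hD (l + 1 + l) (by omega), radialMoment_of_pow hD 1 (by omega)] at h1
  push_cast at h1
  have e1 : (l : ℂ) + 1 ≠ 0 := Nat.cast_add_one_ne_zero _
  have e2 : (l : ℂ) + 2 ≠ 0 := by exact_mod_cast (Nat.succ_ne_zero (l + 1))
  have e3 : (l : ℂ) + 3 ≠ 0 := by exact_mod_cast (Nat.succ_ne_zero (l + 2))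
  have e4 : (l : ℂ) + 1 + (l + 2) + 1 + 2 = 2 * (l + 3) := by ring
  have e5 : (l : ℂ) + 1 + 1 + l + 2 = 2 * (l + 2) := by ring
  have e6 : (l : ℂ) + 1 + l + -1 + 2 = 2 * (l + 1) := by ring
  have e7 : (l : ℂ) + l + 2 = 2 * (l + 1) := by ring
  have e8 : (l : ℂ) + 2 + 1 = l + 3 := by ring
  have e9 : (1 : ℂ) + -1 + 2 = 2 := by ring
  have e10 : (1 : ℂ) + 1 + 2 = 4 := by ring
  rw [e4, e5, e6, e7, e8, e9, e10, show l + 1 + 1 = l + 2 by ring] at h1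
  field_simp at h1
  -- What remains is c(-l)·D/(l+1) = 2c(-l)·D/(l+2), whose cross-multiplied difference is l·c(-l)·D.
  have h3 : (l : ℂ) * (c (-l) * D) = 0 := by linear_combination (1 / 4 : ℂ) * h1
  have hl0 : (l : ℂ) ≠ 0 := by exact_mod_cast (show l ≠ 0 by omega)
  have hD0 : D = 0 := by simpa [hl0, hc] using h3
  filter_upwards [hD] with r hr
  rw [hr, hD0, zero_mul]

lemma HasHarmonicExpansion.aestronglyMeasurable {F : ℂ → ℂ} (h : HasHarmonicExpansion F c) :
    AEStronglyMeasurable F diskMeasure := by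
  refine aestronglyMeasurable_of_tendsto_ae Filter.atTop
    (f := fun (n : ℕ) z => ∑ k ∈ Finset.Icc (-(n : ℤ)) n, c k * harmonicMonomial k z)
    (fun n => ?_) ?_
  · exact (continuous_finsetSum _ fun k _ =>
      continuous_const.mul (continuous_harmonicMonomial k)).aestronglyMeasurable
  · filter_upwards [ae_mem_ball] with z hz
    exact (h z hz).comp (Finset.tendsto_Icc_neg (R := ℤ))

/-! ### Removing the coefficients of index 1 and 0. -/

/-- A harmonic g with c N = 1 has g_N = r^|N|, which equals r^N because N ≥ 0; subtracting D g
therefore cancels the leading coefficient. -/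
lemma TruncatedAbove.sub_smul {g : ℂ → ℂ} {N : ℤ} {D : ℂ} (hf : Integrable f diskMeasure)
    (hg : Integrable g diskMeasure) (hN : TruncatedAbove f N)
    (hgc : HasHarmonicExpansion g c) (hc1 : c N = 1) (hc0 : ∀ n, N < n → c n = 0) (hN0 : 0 ≤ N)
    (hD : ∀ᵐ r : ℝ ∂(volume.restrict (Ioo (0 : ℝ) 1)), polarCoeff f N r = D * (r : ℂ) ^ N) :
    TruncatedAbove (fun z => f z - D * g z) (N - 1) := by
  refine TruncatedAbove.of_zero (fun n hn => PolarCoeffZero.sub_smul hf hg D ?_)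
    (PolarCoeffZero.sub_smul hf hg D ?_)
  · filter_upwards [hN n hn, ae_restrict_mem measurableSet_Ioo] with r hr h0
    rw [hr, hgc.polarCoeff_eq n h0, hc0 n hn]
    simp
  · filter_upwards [hD, ae_restrict_mem measurableSet_Ioo] with r hr h0
    rw [hr, hgc.polarCoeff_eq N h0, hc1, one_mul, ← zpow_natCast, Int.natAbs_of_nonneg hN0]

lemma truncatedAbove_one (hA : HasSymbol A f) (hB : IsShiftSymbol B u c)
    (hAB : A.comp B = B.comp A) {N : ℤ} (hN : TruncatedAbove f N) (h1 : 1 ≤ N) :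
    TruncatedAbove f 1 := by
  induction N, h1 using Int.leInduction with
  | base => exact hN
  | succ n hn ih =>
    refine ih ?_
    simpa using hN.of_zero (polarCoeffZero_of_two_le hA hB hAB hN (by omega))

/-- A symbol with only negative polar coefficients whose Toeplitz operator commutes with `T_u`
vanishes. -/
lemma radialMoment_eq_zero_of_truncatedAbove (hA : HasSymbol A f) (hB : IsShiftSymbol B u c)
    (hAB : A.comp B = B.comp A) (hN : TruncatedAbove f (-1))
    (h : (∃ l : ℕ, 1 ≤ l ∧ c (-l) ≠ 0) ∨ MemLp f 2 diskMeasure) (n : ℤ) (s : ℕ) :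
    radialMoment f n s = 0 := by
  have h1 : PolarCoeffZero f (-1) := by
    rcases h with h | h
    · classical
      obtain ⟨hl, hc⟩ := Nat.find_spec h
      refine polarCoeffZero_neg_one_of_ne_zero hA hB hAB hN hl hc fun i hi hlt => ?_
      by_contra hne
      exact Nat.find_min h hlt ⟨hi, hne⟩
    · obtain ⟨D, hD⟩ := exists_polarCoeff_eq_zpow hA hB hAB hN
      exact polarCoeffZero_neg_one_of_memLp h hD
  -- From -2 downward each leading coefficient is a multiple of a nonintegrable power, so the
  -- truncation index descends without end.
  have h2 : ∀ i : ℕ, TruncatedAbove f (-2 - i) := by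
    intro i
    induction i with
    | zero => simpa using hN.of_zero h1
    | succ i ih =>
      obtain ⟨D, hD⟩ := exists_polarCoeff_eq_zpow hA hB hAB ih
      have := ih.of_zero (polarCoeffZero_of_le_neg_two hA.integrable (by omega) hD)
      rwa [show (-2 : ℤ) - (i + 1 : ℕ) = -2 - i - 1 by push_cast; ring]
  exact (h2 n.natAbs n (by omega)).radialMoment_eq_zero s

/-- Symbols truncated above whose Toeplitz operators commute with `T_u`. -/
lemma exists_eq_of_commute (hA : HasSymbol A f) (hB : IsShiftSymbol B u c)
    (hAB : A.comp B = B.comp A) {N : ℤ} (hN : TruncatedAbove f N) (hN1 : 1 ≤ N)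
    (hu : MemLp u 2 diskMeasure)
    (h : (∃ l : ℕ, 1 ≤ l ∧ c (-l) ≠ 0) ∨ MemLp f 2 diskMeasure) :
    ∃ C₁ C₀ : ℂ, A = C₁ • B + C₀ • ContinuousLinearMap.id ℂ L2h ∧
      ∀ᵐ z ∂diskMeasure, f z = C₁ * u z + C₀ := by
  obtain ⟨C₁, hC₁⟩ := exists_polarCoeff_eq_zpow hA hB hAB (truncatedAbove_one hA hB hAB hN hN1)
  have hA₁ := hA.sub_smul hB.hasSymbol C₁
  have hN₁ := (truncatedAbove_one hA hB hAB hN hN1).sub_smul hA.integrable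
    hB.hasSymbol.integrable hB.expansion hB.one hB.of_one_lt zero_le_one hC₁
  have hAB₁ : (A - C₁ • B).comp B = B.comp (A - C₁ • B) := by
    rw [ContinuousLinearMap.sub_comp, ContinuousLinearMap.comp_sub,
      ContinuousLinearMap.smul_comp, ContinuousLinearMap.comp_smul, hAB]
  rw [sub_self] at hN₁
  obtain ⟨C₀, hC₀⟩ := exists_polarCoeff_eq_zpow hA₁ hB hAB₁ hN₁
  have hA₀ := hA₁.sub_smul hasSymbol_id C₀
  have hN₀ := hN₁.sub_smul hA₁.integrable hasSymbol_id.integrable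
    (harmonicMonomial_hasHarmonicExpansion 0) (by simp)
    (fun n hn => by simp [hn.ne']) le_rfl hC₀
  have hAB₀ : (A - C₁ • B - C₀ • ContinuousLinearMap.id ℂ L2h).comp B =
      B.comp (A - C₁ • B - C₀ • ContinuousLinearMap.id ℂ L2h) := by
    rw [ContinuousLinearMap.sub_comp, ContinuousLinearMap.comp_sub, hAB₁,
      ContinuousLinearMap.smul_comp, ContinuousLinearMap.comp_smul,
      ContinuousLinearMap.id_comp, ContinuousLinearMap.comp_id]
  -- The first alternative concerns only u and is unaffected by the subtractions; the second
  -- survives them because u and 1 are square integrable.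
  have hzero := radialMoment_eq_zero_of_truncatedAbove hA₀ hB hAB₀ hN₀
    (h.imp_right fun hf => (hf.sub (hu.const_mul C₁)).sub
      ((memLp_harmonicMonomial 0).const_mul C₀))
  refine ⟨C₁, C₀, ?_, ?_⟩
  · have h0 : A - C₁ • B - C₀ • ContinuousLinearMap.id ℂ L2h = 0 := by
      refine eq_of_entry_eq fun j k => ?_
      rw [hA₀.entry_eq, hzero]
      simp [entry]
    rw [sub_sub] at h0
    exact sub_eq_zero.1 h0
  · filter_upwards [ae_eq_zero_of_radialMoment hA₀.integrable hzero] with z hz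
    rw [harmonicMonomial_zero] at hz
    linear_combination hz

end Commuting

end HarmonicBergman

end

/-! ### The theorem. -/

theorem theorem3p1
    -- the bounded analytic function `g(z) = ∑_{n ≥ 1} a_n z^n`
    (g : ℂ → ℂ) (a : ℕ → ℂ) (ha : a 0 = 0)
    (hg : ∀ z ∈ ball (0 : ℂ) 1, HasSum (fun n : ℕ => a n * z ^ n) (g z))
    (hgb : ∃ M : ℝ, ∀ z ∈ ball (0 : ℂ) 1, ‖g z‖ ≤ M)
    -- the symbol `f`
    (f : ℂ → ℂ) (hf : Integrable f HarmonicBergman.diskMeasure)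
    (N : ℤ) (hN : 1 ≤ N) (hfN : HarmonicBergman.TruncatedAbove f N)
    -- either `g` is not identically zero, or `f` is square integrable
    (hgf : (∃ n, a n ≠ 0) ∨ MemLp f 2 HarmonicBergman.diskMeasure)
    -- the bounded operators `T_f` and `T_u`, where `u(z) = z + conj (g z)`
    (Tf Tu : HarmonicBergman.L2h →L[ℂ] HarmonicBergman.L2h)
    (hTf : HarmonicBergman.IsToeplitz f Tf)
    (hTu : HarmonicBergman.IsToeplitz (fun z => z + conj (g z)) Tu)
    (hcomm : Tf.comp Tu = Tu.comp Tf) :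
    (∃ C₁ C₀ : ℂ,
      Tf = C₁ • Tu + C₀ • ContinuousLinearMap.id ℂ HarmonicBergman.L2h ∧
      ∀ᵐ z ∂HarmonicBergman.diskMeasure,
        f z = C₁ * z + C₀ + C₁ * ∑' n : ℕ, conj (a n) * conj z ^ n) ∧
    (¬ HarmonicBergman.PolarCoeffZero f N → N = 1) := by
  open HarmonicBergman in
  have hid : ∀ z ∈ ball (0 : ℂ) 1,
      HasSum (fun n : ℕ => (if n = 1 then 1 else 0 : ℂ) * z ^ n) z := fun z _ => by
    refine (hasSum_ite_eq 1 z).congr_fun fun n => ?_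
    split_ifs with h
    · rw [h, pow_one, one_mul]
    · rw [zero_mul]
  have hexp := hasHarmonicExpansion_of_hasSum hid hg
  simp only [ha, sub_zero] at hexp
  obtain ⟨M, hM⟩ := hgb
  have hu : MemLp (fun z => z + conj (g z)) 2 diskMeasure := by
    refine MemLp.of_bound hexp.aestronglyMeasurable (1 + M) ?_
    filter_upwards [ae_mem_ball] with z hz
    refine (norm_add_le _ _).trans (add_le_add (mem_ball_zero_iff.1 hz).le ?_)
    rw [RCLike.norm_conj]
    exact hM z hz
  have hui := hu.integrable (q := 2) (by norm_num)
  have hA : HasSymbol Tf f := ⟨hf, hTf.entry_eq hf⟩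
  have hB : IsShiftSymbol Tu (fun z => z + conj (g z))
      (twoSided (fun n => if n = 1 then 1 else 0) a) :=
    { hasSymbol := ⟨hui, hTu.entry_eq hui⟩
      expansion := hexp
      one := by simp [twoSided]
      zero := by simp [twoSided]
      of_one_lt := fun n hn => by
        have h1 : n.toNat ≠ 1 := by omega
        simp [twoSided, h1, show 0 ≤ n by omega] }
  have hne : (∃ l : ℕ, 1 ≤ l ∧ twoSided (fun n => if n = 1 then 1 else 0) a (-l) ≠ 0) ∨
      MemLp f 2 diskMeasure := by
    refine hgf.imp_left fun ⟨n, hn⟩ => ?_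
    -- Since a 0 = 0, a nonzero coefficient has index m + 1 ≥ 1 and appears, conjugated, at the
    -- negative index -(m+1) of u.
    obtain ⟨m, rfl⟩ := Nat.exists_eq_succ_of_ne_zero fun h : n = 0 => hn (h ▸ ha)
    refine ⟨m + 1, by omega, ?_⟩
    have h := twoSided_neg (fun n => if n = 1 then 1 else 0) a m
    push_cast
    rw [h]
    simpa using hn
  refine ⟨?_, fun hne => ?_⟩
  · obtain ⟨C₁, C₀, hT, hae⟩ := exists_eq_of_commute hA hB hcomm hfN hN hu hne
    refine ⟨C₁, C₀, hT, ?_⟩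
    filter_upwards [hae, ae_mem_ball] with z hz hzb
    have h := (hg z hzb).map (starRingEnd ℂ) Complex.continuous_conj
    have h2 : ∑' n : ℕ, conj (a n) * conj z ^ n = conj (g z) := by
      rw [← h.tsum_eq]
      simp
    rw [hz, h2]
    ring
  · by_contra h
    exact hne (polarCoeffZero_of_two_le hA hB hcomm hfN (by omega))
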